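/- Let $\mathbb{T}$ be the unit circle with normalized arc length measure $m$, let $\mathbb{D}$ be the open unit disc, and let $P_z(\zeta)=\frac{1-|z|^2}{|1-z\bar\zeta|^2}$ ($z\in\mathbb{D}$, $\zeta\in\mathbb{T}$) be the Poisson kernel. Let $w$ be an $A_2$ weight on $\mathbb{T}$, that is, a measurable function with $w>0$ almost everywhere and $$\sup_{I}\Big(\frac{1}{|I|}\int_I w\,dm\Big)\Big(\frac{1}{|I|}\int_I w^{-1}\,dm\Big)<\infty,$$ the supremum being over all (nondegenerate) subarcs $I$ of $\mathbb{T}$, where $|I|=m(I)$. Write $w(I)=\int_I w\,dm$ and $w(z)=\int_{\mathbb{T}} w P_z\,dm$. For a measurable function $\varphi:\mathbb{T}\to\mathbb{C}$ define, with values in $[0,\infty]$, the weighted BMO norm $$\|\varphi\|_{BMO,w}=\sup_{I}\frac{1}{w(I)}\int_I|\varphi-c_I|\,w\,dm,\qquad c_I=\frac{1}{w(I)}\int_I\varphi\, w\,dm,$$ (set equal to $\infty$ if $\varphi\notin L^1(\mathbb{T},w\,dm)$), and the weighted Garsia norm $$\|\varphi\|_{\mathcal{G},w}=\sup_{z\in\mathbb{D}}\Big(\frac{1}{w(z)}\int_{\mathbb{T}}|\varphi-\varphi(z)|^2P_z\,w\,dm\Big)^{1/2},\qquad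 \varphi(z)=\int_{\mathbb{T}}\varphi P_z\,dm,$$ (set equal to $\infty$ if $\varphi\notin L^1(\mathbb{T},m)$). Then the two norms are equivalent: there are constants $C_1,C_2\in(0,\infty)$, depending only on $w$, such that for every measurable $\varphi:\mathbb{T}\to\mathbb{C}$ $$\|\varphi\|_{\mathcal{G},w}\le C_1\|\varphi\|_{BMO,w}\quad\text{and}\quad \|\varphi\|_{BMO,w}\le C_2\|\varphi\|_{\mathcal{G},w}.$$ In particular one norm is finite if and only if the other is. -/

import Mathlib

open MeasureTheory
open scoped ENNReal NNReal

namespace WeightedGarsia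

/-! The unit circle `𝕋` is `UnitAddCircle = ℝ / ℤ`, identified with the unit circle of `ℂ` through
`t ↦ e^{2πit}` (`AddCircle.toCircle`). Its `volume` has total mass one, so it is the normalized
arc length measure `m`. -/

/-- The closed subarc of `𝕋` with centre `c` and normalized length `h`, for `0 < h ≤ 1`. The
distance on `UnitAddCircle` is the normalized arc length distance, so this is the image of
`[s - h / 2, s + h / 2]` when `c` is the class of `s`; for `h = 1` it is all of `𝕋`. Open and
half-open subarcs differ from the closed ones by null sets. -/
def arc (c : UnitAddCircle) (h : ℝ) : Set UnitAddCircle :=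
  Metric.closedBall c (h / 2)

/-- The Poisson kernel `P_z(ζ) = (1 - |z|²) / |1 - z ζ̄|²` at `ζ = e^{2πit}`;
see `poisson_eq` for this formula. -/
noncomputable def poisson (z : ℂ) (t : UnitAddCircle) : ℝ :=
  poissonKernel 0 z (AddCircle.toCircle t : ℂ)

theorem poisson_eq (z : ℂ) (t : UnitAddCircle) :
    poisson z t =
      (1 - ‖z‖ ^ 2) / ‖1 - z * (starRingEnd ℂ) (AddCircle.toCircle t : ℂ)‖ ^ 2 := by
  have h1 : ‖(AddCircle.toCircle t : ℂ)‖ = 1 := Circle.norm_coe _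
  have h2 : (AddCircle.toCircle t : ℂ) * (starRingEnd ℂ) (AddCircle.toCircle t : ℂ) = 1 := by
    rw [Complex.mul_conj, Complex.normSq_eq_norm_sq, h1]; norm_num
  have h3 : ‖1 - z * (starRingEnd ℂ) (AddCircle.toCircle t : ℂ)‖
      = ‖(AddCircle.toCircle t : ℂ) - z‖ := by
    rw [← h2, ← sub_mul, norm_mul, Complex.norm_conj, h1, mul_one]
  simp only [poisson, poissonKernel_def, h3, sub_zero, h1, one_pow]

/-- The characteristic `[w]_{A₂}`, the supremum over all subarcs `I` of
`(|I|⁻¹ ∫_I w dm) (|I|⁻¹ ∫_I w⁻¹ dm)`, with `1 / 0 = ∞`. -/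
noncomputable def a2Characteristic (w : UnitAddCircle → ℝ) : ℝ≥0∞ :=
  ⨆ (c : UnitAddCircle) (h : ℝ) (_ : 0 < h ∧ h ≤ 1),
    ((∫⁻ t in arc c h, ENNReal.ofReal (w t)) / volume (arc c h)) *
      ((∫⁻ t in arc c h, (ENNReal.ofReal (w t))⁻¹) / volume (arc c h))

/-- `w` is a Muckenhoupt `A₂` weight on `𝕋`: measurable, almost everywhere positive, with finite
`A₂` characteristic. -/
structure IsA2Weight (w : UnitAddCircle → ℝ) : Prop where
  aemeasurable : AEMeasurable w volume
  pos : ∀ᵐ t : UnitAddCircle, 0 < w t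
  finite : a2Characteristic w < ∞

/-- The weighted average `c_I = w(I)⁻¹ ∫_I φ w dm` of `φ` over `I`. -/
noncomputable def weightedAverage (w : UnitAddCircle → ℝ) (φ : UnitAddCircle → ℂ)
    (I : Set UnitAddCircle) : ℂ :=
  (∫ t in I, φ t * (w t : ℂ)) / ((∫ t in I, w t : ℝ) : ℂ)

open Classical in
/-- The weighted `BMO` norm, the supremum over all subarcs `I` of
`w(I)⁻¹ ∫_I |φ - c_I| w dm`, with values in `[0, ∞]`. It is infinite when `φ` is not in
`L¹(w dm)`, so that the averages `c_I` are not all defined. -/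
noncomputable def weightedBMONorm (w : UnitAddCircle → ℝ) (φ : UnitAddCircle → ℂ) : ℝ≥0∞ :=
  if Integrable (fun t => φ t * (w t : ℂ)) volume then
    ⨆ (c : UnitAddCircle) (h : ℝ) (_ : 0 < h ∧ h ≤ 1),
      (∫⁻ t in arc c h,
          ENNReal.ofReal (‖φ t - weightedAverage w φ (arc c h)‖ * w t)) /
        (∫⁻ t in arc c h, ENNReal.ofReal (w t))
  else ∞

/-- The harmonic extension `φ(z) = ∫ φ P_z dm`. -/
noncomputable def harmonicExtension (φ : UnitAddCircle → ℂ) (z : ℂ) : ℂ :=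
  ∫ t, φ t * (poisson z t : ℂ)

open Classical in
/-- The weighted Garsia norm, the supremum over `z` in the open unit disc of
`(w(z)⁻¹ ∫ |φ - φ(z)|² P_z w dm)^{1/2}`, where `w(z) = ∫ w P_z dm`, with values in `[0, ∞]`.
It is infinite when `φ` is not in `L¹(dm)`, so that its harmonic extension is not defined. -/
noncomputable def weightedGarsiaNorm (w : UnitAddCircle → ℝ) (φ : UnitAddCircle → ℂ) : ℝ≥0∞ :=
  if Integrable φ volume then
    ⨆ (z : ℂ) (_ : ‖z‖ < 1),
      ((∫⁻ t, ENNReal.ofReal (‖φ t - harmonicExtension φ z‖ ^ 2 * poisson z t * w t)) /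
        (∫⁻ t, ENNReal.ofReal (w t * poisson z t))) ^ (1 / 2 : ℝ)
  else ∞

end WeightedGarsia

/-!
Write `μ = w dm` and `σ = w⁻¹ dm`, and let `A` be the `A₂` characteristic. The `A₂` condition and
the Cauchy–Schwarz inequality say `|B|² ≤ μ(B) σ(B) ≤ A |B|²` for every ball (arc) `B`, where
`|B| = m(B)`, the lower bound even for every measurable set; all geometric estimates follow from
this (`IsA2Pair`). The proof has three ingredients.

*Growth of the mass.* An `A₂` weight is doubling. Applied to the annulus `2B \ B`, the same argument
gives the reverse doubling `σ(B) ≤ q σ(2B)` with `q = 1 - 1 / (4 A) < 1`, as long as `2B` is not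
more than the circle. Together with
`μ(2ᵏB) σ(2ᵏB) ≤ A 4ᵏ |B|² ≤ A 4ᵏ μ(B) σ(B)` this yields `μ(2ᵏB) ≲ (4q)ᵏ μ(B)`
(`IsA2Pair.two_pow_mul_le`). The Poisson kernel at depth `r` below the centre of the ball `B` of
radius `r` is `O(4⁻ᵏ / r)` outside `2ᵏ⁻¹B`, so Poisson averages against `μ` are comparable to
averages over `B`: the geometric gain `qᵏ` absorbs any polynomial growth in `k`
(`IsA2Pair.lintegral_mul_poisson_le`). Without the reverse doubling the growth bound would be `4ᵏ`,
for which the series diverges.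

*The John–Nirenberg inequality.* For a doubling measure, a bound on the mean oscillations of `φ`
over balls bounds the mean square oscillations (`IsDoublingWith.lintegral_sq_norm_sub_average_le`).
The Calderón–Zygmund step `IsDoublingWith.exists_covering` uses a Vitali covering by balls instead
of dyadic arcs; iterating it gives the exponential decay of the distribution function.

*Comparison.* If the `BMO` norm is finite, let `φ_B` be the weighted average over the ball that
belongs to `z`. The averages over `2ᵏB` differ from `φ_B` by `O(k)`, so the first two ingredients
bound the Poisson mean square of `φ - φ_B`; since `|φ(z) - φ_B|²` is at most this mean square times
`σ(z)`, and `w(z) σ(z) ≲ 1`, the constant `φ_B` may be replaced by `φ(z)`. Conversely, the Poisson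
kernel is at least a multiple of `1 / r` on `B` and `w(z) ≲ μ(B) / r`, so a finite Garsia norm
bounds the mean square of `φ - φ(z)` over `B`, and by the Cauchy–Schwarz inequality the mean
oscillation.
-/

namespace WeightedGarsia

open Metric Set Filter Topology

/-! ### The John–Nirenberg inequality for doubling measures -/

section JohnNirenberg

theorem summable_sq_mul_geometric {q : ℝ} (h0 : 0 ≤ q) (h1 : q < 1) :
    Summable fun k : ℕ => ((k : ℝ) + 1) ^ 2 * q ^ k := by
  have h : ‖q‖ < 1 := by rwa [Real.norm_of_nonneg h0]
  have := ((summable_pow_mul_geometric_of_norm_lt_one 2 h).add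
    ((summable_pow_mul_geometric_of_norm_lt_one 1 h).mul_left 2)).add
    (summable_pow_mul_geometric_of_norm_lt_one 0 h)
  refine this.congr fun k => ?_
  ring

variable {X : Type*} [MeasurableSpace X]

theorem norm_setAverage_sub_mul_le {μ : Measure X} [IsFiniteMeasure μ] {f : X → ℂ} {s : Set X}
    (hs : 0 < μ.real s) (hf : Integrable f μ) (a : ℂ) :
    ‖(⨍ y in s, f y ∂μ) - a‖ * μ.real s ≤ ∫ y in s, ‖f y - a‖ ∂μ := by
  have h1 : ∫ y in s, (f y - a) ∂μ = μ.real s • ((⨍ y in s, f y ∂μ) - a) := by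
    rw [integral_sub hf.integrableOn (integrable_const a), setIntegral_const, setAverage_eq,
      smul_sub, smul_inv_smul₀ hs.ne']
  calc _ = ‖∫ y in s, (f y - a) ∂μ‖ := by
        rw [h1, norm_smul, Real.norm_of_nonneg hs.le, mul_comm]
    _ ≤ _ := norm_integral_le_integral_norm _

theorem integrable_norm_sub {μ : Measure X} [IsFiniteMeasure μ] {f : X → ℂ}
    (hf : Integrable f μ) (a : ℂ) : Integrable (fun y => ‖f y - a‖) μ :=
  (hf.sub (integrable_const a)).norm

variable [PseudoMetricSpace X]

/-- A globally doubling measure with constant `D`, all of whose balls have positive mass. The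
masses are real numbers, so this is meant for finite measures. -/
structure IsDoublingWith (μ : Measure X) (D : ℝ) : Prop where
  pos : ∀ x r, 0 < r → 0 < μ.real (closedBall x r)
  two_mul_le : ∀ x r, 0 < r → μ.real (closedBall x (2 * r)) ≤ D * μ.real (closedBall x r)

/-- The mean oscillation of `f` over every closed ball is at most `B`, with respect to `μ`. -/
def MeanOscillationLE (μ : Measure X) (f : X → ℂ) (B : ℝ) : Prop :=
  ∀ x r, 0 < r →
    ∫ y in closedBall x r, ‖f y - ⨍ y in closedBall x r, f y ∂μ‖ ∂μ ≤ B * μ.real (closedBall x r)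

variable {μ : Measure X} [IsFiniteMeasure μ] {D B : ℝ} {f : X → ℂ}

namespace IsDoublingWith

theorem one_le (hμ : IsDoublingWith μ D) (x : X) : 1 ≤ D := by
  have h1 := hμ.two_mul_le x 1 one_pos
  have h2 := hμ.pos x 1 one_pos
  have h3 : μ.real (closedBall x 1) ≤ μ.real (closedBall x (2 * 1)) :=
    measureReal_mono (closedBall_subset_closedBall (by norm_num))
  by_contra! h
  nlinarith

theorem isUnifLocDoublingMeasure (hμ : IsDoublingWith μ D) : IsUnifLocDoublingMeasure μ where
  exists_measure_closedBall_le_mul'' := by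
    refine ⟨D.toNNReal, ?_⟩
    filter_upwards [self_mem_nhdsWithin] with r hr x
    have h := hμ.two_mul_le x r hr
    rw [← ofReal_measureReal, ← ofReal_measureReal]
    refine (ENNReal.ofReal_le_ofReal h).trans ?_
    rw [ENNReal.ofReal_mul (zero_le_one.trans (hμ.one_le x))]
    rfl

theorem norm_average_two_mul_sub_le (hμ : IsDoublingWith μ D) (hf : Integrable f μ)
    (hB : MeanOscillationLE μ f B) (hB0 : 0 ≤ B) (x : X) {r : ℝ} (hr : 0 < r) :
    ‖(⨍ y in closedBall x (2 * r), f y ∂μ) - ⨍ y in closedBall x r, f y ∂μ‖ ≤ D * B := by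
  have h1 := norm_setAverage_sub_mul_le (hμ.pos x r hr) hf (⨍ y in closedBall x (2 * r), f y ∂μ)
  have h2 : ∫ y in closedBall x r, ‖f y - ⨍ y in closedBall x (2 * r), f y ∂μ‖ ∂μ
      ≤ ∫ y in closedBall x (2 * r), ‖f y - ⨍ y in closedBall x (2 * r), f y ∂μ‖ ∂μ :=
    setIntegral_mono_set (integrable_norm_sub hf _).integrableOn
      (ae_of_all _ fun _ => norm_nonneg _)
      (closedBall_subset_closedBall (by linarith)).eventuallyLE
  have h3 := hB x (2 * r) (by linarith)
  have h4 := mul_le_mul_of_nonneg_left (hμ.two_mul_le x r hr) hB0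
  rw [norm_sub_rev]
  refine le_of_mul_le_mul_right (a := μ.real (closedBall x r)) ?_ (hμ.pos x r hr)
  linarith

theorem norm_average_two_pow_sub_le (hμ : IsDoublingWith μ D) (hf : Integrable f μ)
    (hB : MeanOscillationLE μ f B) (hB0 : 0 ≤ B) (x : X) {r : ℝ} (hr : 0 < r) (k : ℕ) :
    ‖(⨍ y in closedBall x (2 ^ k * r), f y ∂μ) - ⨍ y in closedBall x r, f y ∂μ‖
      ≤ k * (D * B) := by
  induction k with
  | zero => simp
  | succ k ih =>
    have h := hμ.norm_average_two_mul_sub_le hf hB hB0 x (r := 2 ^ k * r) (by positivity)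
    rw [← mul_assoc, ← pow_succ'] at h
    have := norm_sub_le_norm_sub_add_norm_sub (⨍ y in closedBall x (2 ^ (k + 1) * r), f y ∂μ)
      (⨍ y in closedBall x (2 ^ k * r), f y ∂μ) (⨍ y in closedBall x r, f y ∂μ)
    push_cast
    linarith

variable [BorelSpace X] [SecondCountableTopology X]

/-- The Calderón–Zygmund step: up to a null set, the part of a ball `I` where `f` is further than
`5 D⁴ B` from its average is covered by balls of total mass at most half that of `I`, over which
the averages of `f` have not moved by more than `5 D⁴ B`. -/
theorem exists_covering (hμ : IsDoublingWith μ D) (hf : Integrable f μ)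
    (hB : MeanOscillationLE μ f B) (hB0 : 0 < B) (c : X) {r : ℝ} (hr : 0 < r) :
    ∃ (u : Set X) (ρ : X → ℝ), u.Countable ∧ (∀ x ∈ u, 0 < ρ x) ∧
      (∀ x ∈ u, ‖(⨍ y in closedBall x (ρ x), f y ∂μ) - ⨍ y in closedBall c r, f y ∂μ‖
        ≤ 5 * D ^ 4 * B) ∧
      (∑' x : u, μ (closedBall (x : X) (ρ x)) ≤ ENNReal.ofReal (μ.real (closedBall c r) / 2)) ∧
      ∀ᵐ x ∂μ, x ∈ closedBall c r →
        5 * D ^ 4 * B < ‖f x - ⨍ y in closedBall c r, f y ∂μ‖ →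
        ∃ y ∈ u, x ∈ closedBall y (ρ y) := by
  have hD := hμ.one_le c
  have hD0 : 0 < D := by linarith
  have := hμ.isUnifLocDoublingMeasure
  set a := ⨍ y in closedBall c r, f y ∂μ with ha
  set g : X → ℝ := fun y => ‖f y - a‖ with hg
  have hgi : Integrable g μ := integrable_norm_sub hf a
  have hg0 : ∀ y, 0 ≤ g y := fun y => norm_nonneg _
  -- at this height the covering balls carry at most half of the mass of `I`
  set t : ℝ := 4 * D ^ 4 * B with ht
  have ht0 : 0 < t := by positivity
  -- the mass of `g` on the doubled ball
  have hmass : ∫ y in closedBall c (2 * r), g y ∂μ ≤ 2 * D ^ 2 * B * μ.real (closedBall c r) := by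
    set b := ⨍ y in closedBall c (2 * r), f y ∂μ with hb
    have h1 : ‖b - a‖ ≤ D * B := hμ.norm_average_two_mul_sub_le hf hB hB0.le c hr
    have h2 : ∫ y in closedBall c (2 * r), g y ∂μ
        ≤ ∫ y in closedBall c (2 * r), (‖f y - b‖ + D * B) ∂μ := by
      refine integral_mono hgi.integrableOn
        ((integrable_norm_sub hf b).add (integrable_const _)).integrableOn fun y => ?_
      exact (norm_sub_le_norm_sub_add_norm_sub _ b _).trans (by simpa using h1)
    rw [integral_add (integrable_norm_sub hf b).integrableOn (integrable_const _),
      setIntegral_const, smul_eq_mul] at h2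
    have h3 := hB c (2 * r) (by linarith)
    have h4 := hμ.two_mul_le c r hr
    have h5 := hμ.pos c r hr
    have h6 := mul_le_mul_of_nonneg_left h4 (show 0 ≤ B + D * B by positivity)
    have h7 : 0 ≤ D * (D - 1) * B * μ.real (closedBall c r) := by
      have : 0 ≤ D - 1 := by linarith
      positivity
    nlinarith
  -- the largest dyadic radius at which the average of `g` exceeds `t`; it exists by Lebesgue
  -- differentiation, and it is smaller than `r` because of the bound for the mass of `g`
  have hradius : ∀ᵐ x ∂μ, x ∈ closedBall c r → 5 * D ^ 4 * B < g x →
      ∃ s, 0 < s ∧ s ≤ r ∧ t * μ.real (closedBall x s) < ∫ y in closedBall x s, g y ∂μ ∧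
        ∫ y in closedBall x (2 * s), g y ∂μ ≤ t * μ.real (closedBall x (2 * s)) := by
    filter_upwards [IsUnifLocDoublingMeasure.ae_tendsto_average μ hgi.locallyIntegrable 1]
      with x hx hxc hgx
    have hlim : Tendsto (fun n : ℕ => r * (1 / 2) ^ n) atTop (𝓝[>] 0) := by
      refine tendsto_nhdsWithin_iff.2 ⟨?_, Eventually.of_forall fun n => by
        simp only [mem_Ioi]; positivity⟩
      simpa using (tendsto_pow_atTop_nhds_zero_of_lt_one (r := (1 / 2 : ℝ)) (by norm_num)
        (by norm_num)).const_mul r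
    have hav := hx (fun _ => x) _ hlim (Eventually.of_forall fun n => by
      simp only [mem_closedBall, dist_self]; positivity)
    have htg : t < g x := by
      have := mul_pos (pow_pos hD0 4) hB0
      simp only [ht]; linarith
    have hex : ∃ n : ℕ, t * μ.real (closedBall x (r * (1 / 2) ^ n))
        < ∫ y in closedBall x (r * (1 / 2) ^ n), g y ∂μ := by
      obtain ⟨n, hn⟩ := (hav.eventually (lt_mem_nhds htg)).exists
      refine ⟨n, ?_⟩
      rw [setAverage_eq, smul_eq_mul, ← div_eq_inv_mul,
        lt_div_iff₀ (hμ.pos x _ (by positivity))] at hn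
      exact hn
    classical
    have hn := Nat.find_spec hex
    have hmin := fun m => Nat.find_min hex (m := m)
    set n := Nat.find hex
    have hn0 : n ≠ 0 := by
      intro h0
      rw [h0, pow_zero, mul_one] at hn
      have h1 : ∫ y in closedBall x r, g y ∂μ ≤ ∫ y in closedBall c (2 * r), g y ∂μ :=
        setIntegral_mono_set hgi.integrableOn (ae_of_all _ hg0)
          (closedBall_subset_closedBall' (by rw [mem_closedBall] at hxc; linarith)).eventuallyLE
      have h2 : μ.real (closedBall c r) ≤ μ.real (closedBall x (2 * r)) :=
        measureReal_mono (closedBall_subset_closedBall'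
          (by rw [mem_closedBall, dist_comm] at hxc; linarith))
      have h3 := hμ.two_mul_le x r hr
      have h4 := hμ.pos x r hr
      have h5 : 2 * D ^ 2 * B * μ.real (closedBall c r)
          ≤ 2 * D ^ 2 * B * (D * μ.real (closedBall x r)) := by gcongr; linarith
      have h6 : 0 ≤ (2 * D - 1) * D ^ 3 * B * μ.real (closedBall x r) := by
        have : 0 ≤ 2 * D - 1 := by linarith
        positivity
      have h7 : 0 < D ^ 4 * B * μ.real (closedBall x r) := by positivity
      simp only [ht] at hn
      nlinarith
    obtain ⟨m, hm⟩ := Nat.exists_eq_succ_of_ne_zero hn0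
    refine ⟨r * (1 / 2) ^ n, by positivity, ?_, hn, ?_⟩
    · exact mul_le_of_le_one_right hr.le (pow_le_one₀ (by norm_num) (by norm_num))
    · have h := hmin m (by omega)
      have : 2 * (r * (1 / 2) ^ n) = r * (1 / 2) ^ m := by rw [hm, pow_succ]; ring
      rw [this]
      exact not_lt.1 h
  set T : Set X := {x | x ∈ closedBall c r ∧ ∃ s, 0 < s ∧ s ≤ r ∧
      t * μ.real (closedBall x s) < ∫ y in closedBall x s, g y ∂μ ∧
        ∫ y in closedBall x (2 * s), g y ∂μ ≤ t * μ.real (closedBall x (2 * s))} with hT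
  choose! s hs0 hsr hs1 hs2 using fun x (hx : x ∈ T) => hx.2
  -- any enlargement factor above `3` would do; the factor `4` is reached by doubling twice
  obtain ⟨u, huT, hdisj, hcov⟩ := Vitali.exists_disjoint_subfamily_covering_enlargement_closedBall
    T (fun x => x) s r hsr 4 (by norm_num)
  have hucount : u.Countable := hdisj.countable_of_nonempty_interior fun x hx =>
    ⟨x, ball_subset_interior_closedBall (mem_ball_self (hs0 x (huT hx)))⟩
  refine ⟨u, fun x => 4 * s x, hucount, fun x hx => by have := hs0 x (huT hx); positivity,
    fun x hx => ?_, ?_, ?_⟩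
  · have hsx := hs0 x (huT hx)
    have h1 := hμ.norm_average_two_mul_sub_le hf hB hB0.le x (r := 2 * s x) (by positivity)
    have h2 : ‖(⨍ y in closedBall x (2 * s x), f y ∂μ) - a‖ ≤ t := by
      have hp := hμ.pos x (2 * s x) (by positivity)
      exact le_of_mul_le_mul_right
        ((norm_setAverage_sub_mul_le hp hf a).trans (hs2 x (huT hx))) hp
    rw [← mul_assoc, show (2 : ℝ) * 2 = 4 by norm_num] at h1
    have h3 := norm_sub_le_norm_sub_add_norm_sub (⨍ y in closedBall x (4 * s x), f y ∂μ)
      (⨍ y in closedBall x (2 * s x), f y ∂μ) a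
    have h4 : D * B ≤ D ^ 4 * B := by
      gcongr
      exact le_self_pow₀ hD (by norm_num)
    simp only [ht] at h2
    linarith
  · have h1 : ∀ x : u, μ (closedBall (x : X) (4 * s x))
        ≤ ENNReal.ofReal (D ^ 2 / t) *
          ∫⁻ y in closedBall (x : X) (s x), ENNReal.ofReal (g y) ∂μ := by
      intro x
      have hsx := hs0 x (huT x.2)
      have h2 := hμ.two_mul_le x (2 * s x) (by positivity)
      have h3 := hμ.two_mul_le x (s x) hsx
      have h4 := hs1 x (huT x.2)
      rw [← ofReal_integral_eq_lintegral_ofReal hgi.integrableOn (ae_of_all _ hg0),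
        ← ENNReal.ofReal_mul (by positivity), ← ofReal_measureReal]
      refine ENNReal.ofReal_le_ofReal ?_
      rw [← mul_assoc, show (2 : ℝ) * 2 = 4 by norm_num] at h2
      have h5 : μ.real (closedBall (x : X) (s x))
          ≤ (∫ y in closedBall (x : X) (s x), g y ∂μ) / t := by
        rw [le_div_iff₀ ht0, mul_comm]; exact h4.le
      calc _ ≤ D * μ.real (closedBall (x : X) (2 * s x)) := h2
        _ ≤ D * (D * μ.real (closedBall (x : X) (s x))) := by gcongr
        _ ≤ D * (D * ((∫ y in closedBall (x : X) (s x), g y ∂μ) / t)) := by gcongr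
        _ = _ := by ring
    have := hucount.to_subtype
    calc _ ≤ ∑' x : u, ENNReal.ofReal (D ^ 2 / t) *
            ∫⁻ y in closedBall (x : X) (s x), ENNReal.ofReal (g y) ∂μ := ENNReal.tsum_le_tsum h1
      _ = ENNReal.ofReal (D ^ 2 / t) *
            ∫⁻ y in ⋃ x ∈ u, closedBall x (s x), ENNReal.ofReal (g y) ∂μ := by
          rw [ENNReal.tsum_mul_left, lintegral_biUnion hucount
            (fun x _ => measurableSet_closedBall) hdisj]
      _ ≤ ENNReal.ofReal (D ^ 2 / t) *
            ∫⁻ y in closedBall c (2 * r), ENNReal.ofReal (g y) ∂μ := by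
          gcongr
          refine iUnion₂_subset fun x hx => closedBall_subset_closedBall' ?_
          have h1 := hsr x (huT hx)
          have h2 := mem_closedBall.1 (huT hx).1
          linarith
      _ ≤ _ := by
          rw [← ofReal_integral_eq_lintegral_ofReal hgi.integrableOn (ae_of_all _ hg0),
            ← ENNReal.ofReal_mul (by positivity)]
          refine ENNReal.ofReal_le_ofReal ?_
          calc _ ≤ D ^ 2 / t * (2 * D ^ 2 * B * μ.real (closedBall c r)) := by gcongr
            _ = _ := by rw [ht]; field_simp; norm_num
  · filter_upwards [hradius] with x hx hxc hgx
    have hxT : x ∈ T := ⟨hxc, hx hxc hgx⟩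
    obtain ⟨y, hy, hsub⟩ := hcov x hxT
    exact ⟨y, hy, hsub (mem_closedBall_self (hs0 x hxT).le)⟩

/-- The John–Nirenberg inequality: the distribution of `f` about its average decays
exponentially. -/
theorem measure_lt_norm_sub_average_le (hμ : IsDoublingWith μ D) (hf : Integrable f μ)
    (hB : MeanOscillationLE μ f B) (hB0 : 0 < B) (k : ℕ) (c : X) {r : ℝ} (hr : 0 < r) :
    μ {x ∈ closedBall c r | k * (5 * D ^ 4 * B) < ‖f x - ⨍ y in closedBall c r, f y ∂μ‖}
      ≤ ENNReal.ofReal ((1 / 2) ^ k * μ.real (closedBall c r)) := by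
  induction k generalizing c r with
  | zero =>
    rw [pow_zero, one_mul, ofReal_measureReal]
    exact measure_mono (sep_subset _ _)
  | succ k ih =>
    obtain ⟨u, ρ, hu, hρ, hav, hsum, hcov⟩ := hμ.exists_covering hf hB hB0 c hr
    have hD := hμ.one_le c
    have := hu.to_subtype
    calc _ ≤ μ (⋃ x ∈ u, {y ∈ closedBall x (ρ x) |
            k * (5 * D ^ 4 * B) < ‖f y - ⨍ z in closedBall x (ρ x), f z ∂μ‖}) := by
          refine measure_mono_ae ?_
          filter_upwards [hcov] with x hx hx'
          obtain ⟨hxc, hlt⟩ : x ∈ closedBall c r ∧ _ := hx'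
          push_cast at hlt
          have hk : 0 ≤ k * (5 * D ^ 4 * B) := by positivity
          obtain ⟨y, hy, hxy⟩ := hx hxc (by linarith)
          refine mem_iUnion₂.2 ⟨y, hy, hxy, ?_⟩
          have h1 := norm_sub_le_norm_sub_add_norm_sub (f x) (⨍ z in closedBall y (ρ y), f z ∂μ)
            (⨍ y in closedBall c r, f y ∂μ)
          have h2 := hav y hy
          linarith
      _ ≤ ∑' x : u, μ {y ∈ closedBall (x : X) (ρ x) |
            k * (5 * D ^ 4 * B) < ‖f y - ⨍ z in closedBall (x : X) (ρ x), f z ∂μ‖} :=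
          measure_biUnion_le _ hu _
      _ ≤ ∑' x : u, ENNReal.ofReal ((1 / 2) ^ k) * μ (closedBall (x : X) (ρ x)) := by
          refine ENNReal.tsum_le_tsum fun x => (ih x (hρ x x.2)).trans_eq ?_
          rw [ENNReal.ofReal_mul (by positivity), ofReal_measureReal]
      _ ≤ ENNReal.ofReal ((1 / 2) ^ k) * ENNReal.ofReal (μ.real (closedBall c r) / 2) := by
          rw [ENNReal.tsum_mul_left]; gcongr
      _ = _ := by
          rw [← ENNReal.ofReal_mul (by positivity)]
          congr 1; ring

/-- The constant of the `L²` form of the John–Nirenberg inequality. -/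
noncomputable def johnNirenbergConstant (D : ℝ) : ℝ :=
  (5 * D ^ 4) ^ 2 * ∑' k : ℕ, ((k : ℝ) + 1) ^ 2 * (1 / 2) ^ k

theorem johnNirenbergConstant_nonneg (D : ℝ) : 0 ≤ johnNirenbergConstant D := by
  unfold johnNirenbergConstant
  positivity

/-- For a doubling measure, a bound for the mean oscillations gives one for the mean square
oscillations. -/
theorem lintegral_sq_norm_sub_average_le (hμ : IsDoublingWith μ D) (hf : Integrable f μ)
    (hB : MeanOscillationLE μ f B) (hB0 : 0 < B) (c : X) {r : ℝ} (hr : 0 < r) :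
    ∫⁻ x in closedBall c r, ENNReal.ofReal (‖f x - ⨍ y in closedBall c r, f y ∂μ‖ ^ 2) ∂μ
      ≤ ENNReal.ofReal (johnNirenbergConstant D * B ^ 2 * μ.real (closedBall c r)) := by
  set a := ⨍ y in closedBall c r, f y ∂μ with ha
  set L := 5 * D ^ 4 * B with hL
  have hD := hμ.one_le c
  have hL0 : 0 < L := by positivity
  set E : ℕ → Set X := fun k => {x ∈ closedBall c r | k * L < ‖f x - a‖} with hE
  have hpt : ∀ x ∈ closedBall c r, ENNReal.ofReal (‖f x - a‖ ^ 2)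
      ≤ ∑' k : ℕ, (E k).indicator (fun _ => ENNReal.ofReal (((k + 1) * L) ^ 2)) x := by
    intro x hx
    rcases (norm_nonneg (f x - a)).eq_or_lt with h0 | h0
    · simp [← h0]
    -- the layer `k L < ‖f x - a‖ ≤ (k + 1) L`
    obtain ⟨n, hn⟩ := exists_nat_ge (‖f x - a‖ / L)
    rw [div_le_iff₀ hL0] at hn
    classical
    have hex : ∃ n : ℕ, ‖f x - a‖ ≤ n * L := ⟨n, hn⟩
    have h1 := Nat.find_spec hex
    have h2 := fun m => Nat.find_min hex (m := m)
    rcases hk : Nat.find hex with _ | k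
    · rw [hk] at h1
      simp only [Nat.cast_zero, zero_mul] at h1
      exact absurd h0 h1.not_gt
    · rw [hk] at h1
      have h3 := not_le.1 (h2 k (by omega))
      refine le_trans ?_ (ENNReal.le_tsum k)
      have hxE : x ∈ E k := ⟨hx, h3⟩
      rw [indicator_of_mem hxE]
      push_cast at h1
      exact ENNReal.ofReal_le_ofReal (by gcongr)
  have hmeas : ∀ k, NullMeasurableSet (E k) μ := fun k =>
    measurableSet_closedBall.nullMeasurableSet.inter
      (nullMeasurableSet_lt aemeasurable_const (integrable_norm_sub hf a).aemeasurable)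
  have hsum := summable_sq_mul_geometric (q := 1 / 2) (by norm_num) (by norm_num)
  calc _ ≤ ∫⁻ x in closedBall c r,
          ∑' k : ℕ, (E k).indicator (fun _ => ENNReal.ofReal (((k + 1) * L) ^ 2)) x ∂μ :=
        setLIntegral_mono' measurableSet_closedBall hpt
    _ ≤ ∫⁻ x, ∑' k : ℕ, (E k).indicator (fun _ => ENNReal.ofReal (((k + 1) * L) ^ 2)) x ∂μ :=
        setLIntegral_le_lintegral _ _
    _ = ∑' k : ℕ, ENNReal.ofReal (((k + 1) * L) ^ 2) * μ (E k) := by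
        rw [lintegral_tsum fun k => (aemeasurable_const.indicator₀ (hmeas k))]
        refine tsum_congr fun k => ?_
        rw [lintegral_indicator₀ (hmeas k), setLIntegral_const]
    _ ≤ ∑' k : ℕ, ENNReal.ofReal (L ^ 2 * μ.real (closedBall c r) *
          (((k : ℝ) + 1) ^ 2 * (1 / 2) ^ k)) := by
        refine ENNReal.tsum_le_tsum fun k => ?_
        refine (mul_le_mul_right (hμ.measure_lt_norm_sub_average_le hf hB hB0 k c hr) _).trans_eq ?_
        rw [← ENNReal.ofReal_mul (by positivity)]
        congr 1; ring
    _ = _ := by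
        rw [← ENNReal.ofReal_tsum_of_nonneg (fun k => by positivity) (hsum.mul_left _),
          tsum_mul_left]
        congr 1
        rw [johnNirenbergConstant, hL]; ring

end IsDoublingWith

end JohnNirenberg

/-! ### Doubling and decay of an `A₂` weight -/

theorem volume_real_closedBall (c : UnitAddCircle) {r : ℝ} (hr : 0 ≤ r) :
    (volume : Measure UnitAddCircle).real (closedBall c r) = min 1 (2 * r) := by
  rw [Measure.real, AddCircle.volume_closedBall, ENNReal.toReal_ofReal]
  positivity

/-- The `A₂` condition with constant `A` in terms of the two measures `μ = w dm` and
`σ = w⁻¹ dm`; the lower bound is the Cauchy–Schwarz inequality. The condition is symmetric in `μ`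
and `σ`, and the closed balls of radius `r ≥ 1 / 2` are the whole circle. -/
structure IsA2Pair (μ σ : Measure UnitAddCircle) (A : ℝ) : Prop where
  sq_le : ∀ s, MeasurableSet s →
    (volume : Measure UnitAddCircle).real s ^ 2 ≤ μ.real s * σ.real s
  mul_le : ∀ c r, 0 < r → μ.real (closedBall c r) * σ.real (closedBall c r)
    ≤ A * (volume : Measure UnitAddCircle).real (closedBall c r) ^ 2

namespace IsA2Pair

variable {μ σ : Measure UnitAddCircle} {A : ℝ}

theorem symm (h : IsA2Pair μ σ A) : IsA2Pair σ μ A where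
  sq_le s hs := by rw [mul_comm]; exact h.sq_le s hs
  mul_le c r hr := by rw [mul_comm]; exact h.mul_le c r hr

theorem pos (h : IsA2Pair μ σ A) (c : UnitAddCircle) {r : ℝ} (hr : 0 < r) :
    0 < μ.real (closedBall c r) := by
  have h1 := h.sq_le _ (measurableSet_closedBall (x := c) (ε := r))
  have h2 : (0 : ℝ) < min 1 (2 * r) := by positivity
  rw [volume_real_closedBall c hr.le] at h1
  refine measureReal_nonneg.lt_of_ne fun h0 => ?_
  rw [← h0, zero_mul] at h1
  exact absurd (pow_pos h2 2) h1.not_gt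

theorem one_le (h : IsA2Pair μ σ A) : 1 ≤ A := by
  have h1 := h.sq_le _ (measurableSet_closedBall (x := 0) (ε := 1))
  have h2 := h.mul_le 0 1 one_pos
  rw [volume_real_closedBall 0 zero_le_one] at h1 h2
  norm_num at h1 h2
  linarith

variable [IsFiniteMeasure σ]

/-- A subset of a ball that carries part of its length carries a corresponding part of its
mass. -/
theorem sq_mul_le (h : IsA2Pair μ σ A) {c : UnitAddCircle} {r : ℝ} (hr : 0 < r)
    {s : Set UnitAddCircle} (hs : MeasurableSet s) (hsub : s ⊆ closedBall c r) :
    (volume : Measure UnitAddCircle).real s ^ 2 * μ.real (closedBall c r)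
      ≤ A * (volume : Measure UnitAddCircle).real (closedBall c r) ^ 2 * μ.real s := by
  have h1 : μ.real s * σ.real s ≤ μ.real s * σ.real (closedBall c r) := by
    gcongr
    exact measure_ne_top _ _
  calc _ ≤ μ.real s * σ.real (closedBall c r) * μ.real (closedBall c r) := by
        gcongr
        exact (h.sq_le s hs).trans h1
    _ = μ.real s * (μ.real (closedBall c r) * σ.real (closedBall c r)) := by ring
    _ ≤ μ.real s * (A * (volume : Measure UnitAddCircle).real (closedBall c r) ^ 2) := by
        exact mul_le_mul_of_nonneg_left (h.mul_le c r hr) measureReal_nonneg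
    _ = _ := by ring

theorem isDoublingWith (h : IsA2Pair μ σ A) : IsDoublingWith μ (4 * A) where
  pos c r hr := h.pos c hr
  two_mul_le c r hr := by
    have h1 := h.sq_mul_le (c := c) (r := 2 * r) (by positivity)
      (measurableSet_closedBall (x := c) (ε := r)) (closedBall_subset_closedBall (by linarith))
    rw [volume_real_closedBall c hr.le, volume_real_closedBall c (by positivity)] at h1
    have h2 : min 1 (2 * (2 * r)) ≤ 2 * min 1 (2 * r) := by
      rcases le_total 1 (2 * r) with h | h <;> simp [h]
    have h3 : (0 : ℝ) < min 1 (2 * r) := by positivity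
    have h4 : (0 : ℝ) ≤ min 1 (2 * (2 * r)) := by positivity
    have hA := h.one_le
    refine le_of_mul_le_mul_left (h1.trans ?_) (pow_pos h3 2)
    calc _ ≤ A * (2 * min 1 (2 * r)) ^ 2 * μ.real (closedBall c r) := by gcongr
      _ = _ := by ring

variable [IsFiniteMeasure μ]

/-- Reverse doubling: the annulus `2B \ B` carries a fixed part of the mass of `2B`. -/
theorem le_two_mul (h : IsA2Pair μ σ A) (c : UnitAddCircle) {r : ℝ} (hr : 0 < r)
    (hr1 : 4 * r ≤ 1) :
    μ.real (closedBall c r) ≤ (1 - 1 / (4 * A)) * μ.real (closedBall c (2 * r)) := by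
  have hsub : closedBall c r ⊆ closedBall c (2 * r) := closedBall_subset_closedBall (by linarith)
  have h1 := h.sq_mul_le (c := c) (r := 2 * r) (by positivity)
    (measurableSet_closedBall.diff measurableSet_closedBall) (sdiff_subset (t := closedBall c r))
  rw [measureReal_sdiff hsub measurableSet_closedBall,
    measureReal_sdiff hsub measurableSet_closedBall,
    volume_real_closedBall c hr.le, volume_real_closedBall c (by positivity),
    min_eq_right (by linarith), min_eq_right (by linarith)] at h1
  have hA : 0 < A := by linarith [h.one_le]
  have h2 : 0 < 4 * r ^ 2 := by positivity
  have h3 : μ.real (closedBall c (2 * r))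
      ≤ 4 * A * (μ.real (closedBall c (2 * r)) - μ.real (closedBall c r)) := by
    refine le_of_mul_le_mul_left (Eq.trans_le ?_ (h1.trans_eq ?_)) h2 <;> ring
  have h4 : μ.real (closedBall c (2 * r)) / (4 * A)
      ≤ μ.real (closedBall c (2 * r)) - μ.real (closedBall c r) := by
    rw [div_le_iff₀ (by positivity)]; linarith
  calc _ ≤ μ.real (closedBall c (2 * r)) - μ.real (closedBall c (2 * r)) / (4 * A) := by linarith
    _ = _ := by ring

theorem le_two_pow_mul (h : IsA2Pair μ σ A) (c : UnitAddCircle) {r : ℝ} (hr : 0 < r) (k : ℕ)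
    (hr1 : 2 ^ k * r ≤ 1 / 2) :
    μ.real (closedBall c r) ≤ (1 - 1 / (4 * A)) ^ k * μ.real (closedBall c (2 ^ k * r)) := by
  have hA : 1 / (4 * A) ≤ 1 := by
    rw [div_le_one] <;> linarith [h.one_le]
  induction k with
  | zero => simp
  | succ k ih =>
    have h1 : 4 * (2 ^ k * r) ≤ 1 := by rw [pow_succ] at hr1; linarith
    have h2 := h.le_two_mul c (r := 2 ^ k * r) (by positivity) h1
    rw [← mul_assoc, ← pow_succ'] at h2
    have h3 : 0 ≤ (1 - 1 / (4 * A)) ^ k := pow_nonneg (by linarith) k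
    calc _ ≤ _ := ih (by nlinarith [pow_pos (two_pos (α := ℝ)) k])
      _ ≤ _ := mul_le_mul_of_nonneg_left h2 h3
      _ = _ := by ring

/-- The mass of the dilates `2ᵏB` grows by a factor strictly smaller than `4`. The factor
`4` is that of the `A₂` condition; the gain comes from the reverse doubling of `σ`. -/
theorem two_pow_mul_le (h : IsA2Pair μ σ A) (c : UnitAddCircle) {r : ℝ} (hr : 0 < r) (k : ℕ)
    (hr1 : 2 ^ k * r ≤ 1) :
    μ.real (closedBall c (2 ^ k * r))
      ≤ 4 * A ^ 2 * (4 * (1 - 1 / (4 * A))) ^ k * μ.real (closedBall c r) := by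
  have hA := h.one_le
  have hA4 : 1 / (4 * A) ≤ 1 / 4 := by
    rw [div_le_div_iff₀] <;> linarith
  have key : ∀ k : ℕ, 2 ^ k * r ≤ 1 / 2 → μ.real (closedBall c (2 ^ k * r))
      ≤ A * (4 * (1 - 1 / (4 * A))) ^ k * μ.real (closedBall c r) := by
    intro k hk
    have hk0 : 0 < 2 ^ k * r := by positivity
    have hrk : r ≤ 2 ^ k * r := le_mul_of_one_le_left hr.le (one_le_pow₀ (by norm_num))
    have h1 := h.mul_le c (2 ^ k * r) hk0
    have h2 := h.sq_le _ (measurableSet_closedBall (x := c) (ε := r))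
    rw [volume_real_closedBall c hk0.le, min_eq_right (by linarith)] at h1
    rw [volume_real_closedBall c hr.le, min_eq_right (by linarith)] at h2
    refine le_of_mul_le_mul_right ?_ (h.symm.pos c hk0)
    have h4 : (2 * (2 ^ k * r)) ^ 2 = 4 ^ k * (2 * r) ^ 2 := by
      rw [show (4 : ℝ) = 2 ^ 2 by norm_num, ← pow_mul, mul_comm 2 k, pow_mul]; ring
    calc _ ≤ A * (4 ^ k * (2 * r) ^ 2) := by rw [← h4]; exact h1
      _ ≤ A * (4 ^ k * (μ.real (closedBall c r) * σ.real (closedBall c r))) := by gcongr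
      _ ≤ A * (4 ^ k * (μ.real (closedBall c r) *
            ((1 - 1 / (4 * A)) ^ k * σ.real (closedBall c (2 ^ k * r))))) := by
          gcongr
          exact h.symm.le_two_pow_mul c hr k hk
      _ = _ := by rw [mul_pow]; ring
  have hq : 1 ≤ 4 * (1 - 1 / (4 * A)) := by linarith
  have hm := h.pos c hr
  rcases k with _ | k
  · simp only [pow_zero, one_mul, mul_one]
    exact le_mul_of_one_le_left hm.le (by nlinarith)
  · have h2 : 2 ^ k * r ≤ 1 / 2 := by rw [pow_succ] at hr1; linarith
    have h3 := h.isDoublingWith.two_mul_le c (2 ^ k * r) (by positivity)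
    rw [← mul_assoc, ← pow_succ'] at h3
    calc _ ≤ _ := h3
      _ ≤ 4 * A * (A * (4 * (1 - 1 / (4 * A))) ^ k * μ.real (closedBall c r)) := by
          gcongr; exact key k h2
      _ = 4 * A ^ 2 * (4 * (1 - 1 / (4 * A))) ^ k * μ.real (closedBall c r) := by ring
      _ ≤ _ := by
          gcongr
          exact k.le_succ

end IsA2Pair

/-! ### Bounds for the Poisson kernel -/

theorem norm_toCircle_sub (s t : UnitAddCircle) :
    ‖(AddCircle.toCircle s : ℂ) - AddCircle.toCircle t‖ = 2 * Real.sin (Real.pi * dist s t) := by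
  have h1 : ‖(AddCircle.toCircle s : ℂ) - AddCircle.toCircle t‖
      = ‖(AddCircle.toCircle (s - t) : ℂ) - 1‖ := by
    have h : (AddCircle.toCircle s : ℂ) = AddCircle.toCircle (s - t) * AddCircle.toCircle t := by
      rw [← Circle.coe_mul, ← AddCircle.toCircle_add, sub_add_cancel]
    rw [h, ← sub_one_mul, norm_mul, Circle.norm_coe, mul_one]
  rw [h1, dist_eq_norm]
  obtain ⟨x, hx, hx'⟩ : ∃ x : ℝ, (x : UnitAddCircle) = s - t ∧ |x| ≤ 1 / 2 := by
    obtain ⟨y, hy⟩ := QuotientAddGroup.mk_surjective (s - t)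
    refine ⟨y - round y, ?_, abs_sub_round y⟩
    rw [← hy]
    have : ((round y : ℝ) : UnitAddCircle) = 0 := by
      exact_mod_cast AddCircle.coe_eq_zero_iff (p := (1 : ℝ)) |>.2 ⟨round y, by simp⟩
    rw [AddCircle.coe_sub, this, sub_zero]
  have h2 : ‖(x : UnitAddCircle)‖ = |x| :=
    (AddCircle.norm_coe_eq_abs_iff 1 one_ne_zero).2 (by simpa using hx')
  rw [← hx, h2, AddCircle.toCircle_apply_mk, Circle.coe_exp]
  have h3 := Complex.norm_exp_I_mul_ofReal_sub_one (2 * Real.pi / 1 * x)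
  rw [mul_comm Complex.I] at h3
  rw [h3, norm_mul, Real.norm_eq_abs, Real.norm_eq_abs, abs_two]
  congr 1
  rw [show 2 * Real.pi / 1 * x / 2 = Real.pi * x by ring]
  have h5 : |Real.pi * x| = Real.pi * |x| := by rw [abs_mul, abs_of_pos Real.pi_pos]
  rw [← h5, Real.abs_sin_eq_sin_abs_of_abs_le_pi]
  rw [h5]
  nlinarith [Real.pi_pos]

theorem dist_le_half (s t : UnitAddCircle) : dist s t ≤ 1 / 2 := by
  rw [dist_eq_norm]
  simpa using AddCircle.norm_le_half_period (1 : ℝ) one_ne_zero (x := s - t)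

theorem four_mul_dist_le_norm_toCircle_sub (s t : UnitAddCircle) :
    4 * dist s t ≤ ‖(AddCircle.toCircle s : ℂ) - AddCircle.toCircle t‖ := by
  have h := dist_le_half s t
  have h1 := Real.mul_le_sin (x := Real.pi * dist s t) (by positivity)
    (by nlinarith [Real.pi_pos])
  have h2 : 2 / Real.pi * (Real.pi * dist s t) = 2 * dist s t := by
    field_simp
  rw [norm_toCircle_sub]
  linarith

theorem norm_toCircle_sub_le (s t : UnitAddCircle) :
    ‖(AddCircle.toCircle s : ℂ) - AddCircle.toCircle t‖ ≤ 7 * dist s t := by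
  have h1 := Real.sin_le (x := Real.pi * dist s t) (by positivity)
  rw [norm_toCircle_sub]
  nlinarith [Real.pi_lt_d2, dist_nonneg (x := s) (y := t)]

/-- The point `(1 - r) e^{2πic}` at depth `r` below the boundary point `c`. -/
noncomputable def diskPoint (c : UnitAddCircle) (r : ℝ) : ℂ :=
  (1 - r : ℝ) * (AddCircle.toCircle c : ℂ)

theorem exists_eq_diskPoint {z : ℂ} (hz : ‖z‖ < 1) :
    ∃ c r, 0 < r ∧ r ≤ 1 ∧ z = diskPoint c r := by
  refine ⟨(Complex.arg z / (2 * Real.pi) : ℝ), 1 - ‖z‖, by linarith,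
    by linarith [norm_nonneg z], ?_⟩
  have h : 2 * Real.pi / 1 * (Complex.arg z / (2 * Real.pi)) = Complex.arg z := by
    field_simp
  rw [diskPoint, AddCircle.toCircle_apply_mk, h, Circle.coe_exp, sub_sub_cancel,
    Complex.norm_mul_exp_arg_mul_I]

section

variable {c t : UnitAddCircle} {r : ℝ}

theorem norm_diskPoint (hr1 : r ≤ 1) : ‖diskPoint c r‖ = 1 - r := by
  rw [diskPoint, norm_mul, Circle.norm_coe, mul_one, Complex.norm_real,
    Real.norm_of_nonneg (by linarith)]

theorem norm_diskPoint_lt_one (hr : 0 < r) (hr1 : r ≤ 1) : ‖diskPoint c r‖ < 1 := by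
  rw [norm_diskPoint hr1]; linarith

theorem poisson_diskPoint (hr1 : r ≤ 1) : poisson (diskPoint c r) t
    = r * (2 - r) / ‖(AddCircle.toCircle t : ℂ) - diskPoint c r‖ ^ 2 := by
  rw [poisson, poissonKernel_def]
  simp only [sub_zero, Circle.norm_coe, norm_diskPoint hr1]
  congr 1; ring

theorem norm_toCircle_sub_diskPoint (hr : 0 < r) :
    ‖(AddCircle.toCircle c : ℂ) - diskPoint c r‖ = r := by
  have : (AddCircle.toCircle c : ℂ) - diskPoint c r = (r : ℂ) * AddCircle.toCircle c := by
    rw [diskPoint]; push_cast; ring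
  rw [this, norm_mul, Circle.norm_coe, mul_one, Complex.norm_real, Real.norm_of_nonneg hr.le]

theorem le_norm_sub_diskPoint (hr1 : r ≤ 1) :
    r ≤ ‖(AddCircle.toCircle t : ℂ) - diskPoint c r‖ := by
  have h := norm_sub_norm_le (AddCircle.toCircle t : ℂ) (diskPoint c r)
  rw [Circle.norm_coe, norm_diskPoint hr1] at h
  linarith

/-- The distance to an interior point is comparable to the one to its boundary point, since
`|e^{2πit} - e^{2πic}| ≤ |e^{2πit} - z| + r ≤ 2 |e^{2πit} - z|`. -/
theorem two_mul_dist_le_norm_sub_diskPoint (hr : 0 < r) (hr1 : r ≤ 1) :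
    2 * dist t c ≤ ‖(AddCircle.toCircle t : ℂ) - diskPoint c r‖ := by
  have h1 := four_mul_dist_le_norm_toCircle_sub t c
  have h2 := norm_sub_le_norm_sub_add_norm_sub (AddCircle.toCircle t : ℂ) (diskPoint c r)
    (AddCircle.toCircle c)
  rw [norm_sub_rev (diskPoint c r), norm_toCircle_sub_diskPoint hr] at h2
  linarith [le_norm_sub_diskPoint (c := c) (t := t) hr1]

theorem poisson_diskPoint_nonneg (hr : 0 < r) (hr1 : r ≤ 1) :
    0 ≤ poisson (diskPoint c r) t := by
  have : 0 ≤ 2 - r := by linarith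
  rw [poisson_diskPoint hr1]; positivity

theorem poisson_diskPoint_le (hr : 0 < r) (hr1 : r ≤ 1) {L : ℝ} (hL : 0 < L)
    (h : L ≤ ‖(AddCircle.toCircle t : ℂ) - diskPoint c r‖) :
    poisson (diskPoint c r) t ≤ 2 * r / L ^ 2 := by
  rw [poisson_diskPoint hr1]
  exact div_le_div₀ (by positivity) (by nlinarith) (by positivity) (by gcongr)

theorem le_poisson_diskPoint (hr : 0 < r) (hr1 : r ≤ 1) (ht : t ∈ closedBall c r) :
    1 / (64 * r) ≤ poisson (diskPoint c r) t := by
  have h1 := norm_toCircle_sub_le t c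
  have h2 := norm_sub_le_norm_sub_add_norm_sub (AddCircle.toCircle t : ℂ)
    (AddCircle.toCircle c) (diskPoint c r)
  rw [norm_toCircle_sub_diskPoint hr] at h2
  have h3 : ‖(AddCircle.toCircle t : ℂ) - diskPoint c r‖ ≤ 8 * r := by
    linarith [mem_closedBall.1 ht]
  have h4 := le_norm_sub_diskPoint (c := c) (t := t) hr1
  rw [poisson_diskPoint hr1]
  calc 1 / (64 * r) = r * 1 / (8 * r) ^ 2 := by field_simp; norm_num
    _ ≤ r * (2 - r) / (8 * r) ^ 2 := by gcongr; linarith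
    _ ≤ _ := by
        have : 0 ≤ 2 - r := by linarith
        have : 0 < ‖(AddCircle.toCircle t : ℂ) - diskPoint c r‖ := by linarith
        gcongr

theorem continuous_poisson_diskPoint (hr : 0 < r) (hr1 : r ≤ 1) :
    Continuous (poisson (diskPoint c r)) := by
  have h : poisson (diskPoint c r)
      = fun t => r * (2 - r) / ‖(AddCircle.toCircle t : ℂ) - diskPoint c r‖ ^ 2 :=
    funext fun t => poisson_diskPoint hr1
  rw [h]
  have hc : Continuous fun t : UnitAddCircle => (AddCircle.toCircle t : ℂ) :=
    continuous_subtype_val.comp AddCircle.continuous_toCircle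
  refine continuous_const.div ((hc.sub continuous_const).norm.pow 2) fun t => ?_
  have := le_norm_sub_diskPoint (c := c) (t := t) hr1
  exact (pow_pos (hr.trans_le this) 2).ne'

/-- Some dilate `2ᴷB` is the whole circle while its radius is still at most `1`. -/
theorem exists_two_pow_mul_mem_Icc (hr : 0 < r) (hr1 : r ≤ 1) :
    ∃ K : ℕ, 1 / 2 ≤ 2 ^ K * r ∧ 2 ^ K * r ≤ 1 := by
  have hex : ∃ K : ℕ, 1 / 2 ≤ 2 ^ K * r := by
    obtain ⟨K, hK⟩ := pow_unbounded_of_one_lt (1 / 2 / r) (one_lt_two (α := ℝ))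
    exact ⟨K, ((div_lt_iff₀ hr).1 hK).le⟩
  classical
  refine ⟨Nat.find hex, Nat.find_spec hex, ?_⟩
  rcases hk : Nat.find hex with _ | k
  · simpa using hr1
  · have := not_le.1 (Nat.find_min hex (m := k) (by omega))
    rw [pow_succ]; linarith

/-- The Poisson kernel is dominated by a combination of indicators of dilated balls, with weights
that decay like `4⁻ᵏ`. -/
theorem poisson_diskPoint_le_sum (hr : 0 < r) (hr1 : r ≤ 1) {K : ℕ} (hK : 1 / 2 ≤ 2 ^ K * r) :
    ENNReal.ofReal (poisson (diskPoint c r) t) ≤ ∑ k ∈ Finset.range (K + 1),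
      (closedBall c (2 ^ k * r)).indicator
        (fun _ => ENNReal.ofReal (2 / r * (1 / 4) ^ k)) t := by
  have hex : ∃ k : ℕ, t ∈ closedBall c (2 ^ k * r) :=
    ⟨K, mem_closedBall.2 ((dist_le_half t c).trans hK)⟩
  classical
  have h1 := Nat.find_spec hex
  have h2 := fun m => Nat.find_min hex (m := m)
  have h3 : Nat.find hex ≤ K :=
    Nat.find_min' hex (mem_closedBall.2 ((dist_le_half t c).trans hK))
  refine le_trans ?_ (Finset.single_le_sum (fun _ _ => zero_le)
    (Finset.mem_range.2 (Nat.lt_succ_of_le h3)))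
  rw [indicator_of_mem h1]
  refine ENNReal.ofReal_le_ofReal ?_
  have h4 : 2 ^ Nat.find hex * r ≤ ‖(AddCircle.toCircle t : ℂ) - diskPoint c r‖ := by
    rcases hk : Nat.find hex with _ | k
    · simpa using le_norm_sub_diskPoint (c := c) (t := t) hr1
    · have h5 := h2 k (by omega)
      rw [mem_closedBall, not_le] at h5
      have h6 := two_mul_dist_le_norm_sub_diskPoint (c := c) (t := t) hr hr1
      rw [pow_succ]; linarith
  refine (poisson_diskPoint_le hr hr1 (by positivity) h4).trans_eq ?_
  rw [mul_pow, ← pow_mul, mul_comm (Nat.find hex), pow_mul, one_div, inv_pow]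
  norm_num
  field_simp

theorem lintegral_mul_poisson_le (hr : 0 < r) (hr1 : r ≤ 1) {K : ℕ} (hK : 1 / 2 ≤ 2 ^ K * r)
    (ν : Measure UnitAddCircle) {F : UnitAddCircle → ℝ≥0∞} (hF : AEMeasurable F ν) :
    ∫⁻ t, F t * ENNReal.ofReal (poisson (diskPoint c r) t) ∂ν
      ≤ ∑ k ∈ Finset.range (K + 1), ENNReal.ofReal (2 / r * (1 / 4) ^ k) *
        ∫⁻ t in closedBall c (2 ^ k * r), F t ∂ν := by
  calc _ ≤ ∫⁻ t, ∑ k ∈ Finset.range (K + 1), (closedBall c (2 ^ k * r)).indicator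
          (fun t => ENNReal.ofReal (2 / r * (1 / 4) ^ k) * F t) t ∂ν := by
        refine lintegral_mono fun t => ?_
        refine (mul_le_mul_right (poisson_diskPoint_le_sum hr hr1 hK) (F t)).trans_eq ?_
        rw [Finset.mul_sum]
        refine Finset.sum_congr rfl fun k _ => ?_
        by_cases h : t ∈ closedBall c (2 ^ k * r)
        · rw [indicator_of_mem h, indicator_of_mem h, mul_comm]
        · rw [indicator_of_notMem h, indicator_of_notMem h, mul_zero]
    _ = _ := by
        rw [lintegral_finsetSum' _ fun k _ =>
          (hF.const_mul _).indicator measurableSet_closedBall]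
        refine Finset.sum_congr rfl fun k _ => ?_
        rw [lintegral_indicator measurableSet_closedBall,
          lintegral_const_mul' _ _ ENNReal.ofReal_ne_top]

theorem le_lintegral_mul_poisson (hr : 0 < r) (hr1 : r ≤ 1) (ν : Measure UnitAddCircle)
    (F : UnitAddCircle → ℝ≥0∞) :
    ENNReal.ofReal (1 / (64 * r)) * ∫⁻ t in closedBall c r, F t ∂ν
      ≤ ∫⁻ t, F t * ENNReal.ofReal (poisson (diskPoint c r) t) ∂ν := by
  rw [← lintegral_const_mul' _ _ ENNReal.ofReal_ne_top]
  refine (setLIntegral_mono' measurableSet_closedBall fun t ht => ?_).trans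
    (setLIntegral_le_lintegral _ _)
  rw [mul_comm]
  gcongr
  exact le_poisson_diskPoint hr hr1 ht

end

/-! ### Poisson averages against an `A₂` weight -/

/-- The Cauchy–Schwarz inequality for a function dominated by a geometric mean. -/
theorem sq_lintegral_le_of_le_sqrt_mul {X : Type*} [MeasurableSpace X] {ν : Measure X}
    {g F G : X → ℝ≥0∞} (hF : AEMeasurable F ν) (hG : AEMeasurable G ν)
    (h : ∀ᵐ x ∂ν, g x ≤ F x ^ (1 / 2 : ℝ) * G x ^ (1 / 2 : ℝ)) :
    (∫⁻ x, g x ∂ν) ^ 2 ≤ (∫⁻ x, F x ∂ν) * ∫⁻ x, G x ∂ν := by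
  have h1 := (lintegral_mono_ae h).trans
    (ENNReal.lintegral_mul_norm_pow_le hF hG (p := 1 / 2) (q := 1 / 2)
      (by norm_num) (by norm_num) (by norm_num))
  rw [← ENNReal.mul_rpow_of_nonneg _ _ (by norm_num)] at h1
  refine (pow_le_pow_left' h1 2).trans_eq ?_
  rw [← ENNReal.rpow_natCast, ← ENNReal.rpow_mul]
  norm_num

theorem ofReal_sq_norm_sub_le (x a b : ℂ) : ENNReal.ofReal (‖x - b‖ ^ 2)
    ≤ 2 * ENNReal.ofReal (‖x - a‖ ^ 2) + 2 * ENNReal.ofReal (‖a - b‖ ^ 2) := by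
  rw [← ENNReal.ofReal_ofNat 2, ← ENNReal.ofReal_mul (by norm_num),
    ← ENNReal.ofReal_mul (by norm_num), ← ENNReal.ofReal_add (by positivity) (by positivity)]
  refine ENNReal.ofReal_le_ofReal ?_
  have h := norm_sub_le_norm_sub_add_norm_sub x a b
  calc ‖x - b‖ ^ 2 ≤ (‖x - a‖ + ‖a - b‖) ^ 2 := by gcongr
    _ ≤ _ := by nlinarith [sq_nonneg (‖x - a‖ - ‖a - b‖)]

namespace IsA2Pair

variable {μ σ : Measure UnitAddCircle} {A : ℝ}

/-- The constant in the upper bounds for Poisson averages: `2` from the kernel and `4 A²` from the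
growth of the mass, times the sum over the dilates. -/
noncomputable def poissonConstant (A : ℝ) : ℝ :=
  8 * A ^ 2 * ∑' k : ℕ, ((k : ℝ) + 1) ^ 2 * (1 - 1 / (4 * A)) ^ k

theorem poissonConstant_nonneg (h : IsA2Pair μ σ A) : 0 ≤ poissonConstant A := by
  have : 0 ≤ 1 - 1 / (4 * A) := by
    rw [sub_nonneg, div_le_one] <;> linarith [h.one_le]
  unfold poissonConstant
  positivity

theorem le_lintegral_poisson [IsFiniteMeasure μ] (c : UnitAddCircle) {r : ℝ} (hr : 0 < r)
    (hr1 : r ≤ 1) :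
    ENNReal.ofReal (μ.real (closedBall c r) / (64 * r))
      ≤ ∫⁻ t, ENNReal.ofReal (poisson (diskPoint c r) t) ∂μ := by
  have := le_lintegral_mul_poisson (c := c) hr hr1 μ fun _ => 1
  rw [lintegral_one, Measure.restrict_apply_univ, ← ofReal_measureReal,
    ← ENNReal.ofReal_mul (by positivity), one_div_mul_eq_div] at this
  simpa using this

variable [IsFiniteMeasure μ] [IsFiniteMeasure σ]

/-- A function whose averages over the dilates `2ᵏB` grow at most quadratically in `k` has a
Poisson average comparable to the one over `B`: the mass of `2ᵏB` grows more slowly than the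
Poisson kernel decays. -/
theorem lintegral_mul_poisson_le (h : IsA2Pair μ σ A) {c : UnitAddCircle} {r : ℝ} (hr : 0 < r)
    (hr1 : r ≤ 1) {F : UnitAddCircle → ℝ≥0∞} (hF : AEMeasurable F μ) {m : ℝ} (hm : 0 ≤ m)
    (hFm : ∀ k : ℕ, ∫⁻ t in closedBall c (2 ^ k * r), F t ∂μ
      ≤ ENNReal.ofReal (m * ((k : ℝ) + 1) ^ 2 * μ.real (closedBall c (2 ^ k * r)))) :
    ∫⁻ t, F t * ENNReal.ofReal (poisson (diskPoint c r) t) ∂μ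
      ≤ ENNReal.ofReal (m * poissonConstant A * μ.real (closedBall c r) / r) := by
  obtain ⟨K, hK, hK1⟩ := exists_two_pow_mul_mem_Icc hr hr1
  have hA := h.one_le
  set q := 1 - 1 / (4 * A) with hq
  have hq0 : 0 ≤ q := by
    rw [hq, sub_nonneg, div_le_one] <;> linarith
  have hq1 : q < 1 := by
    have : 0 < 1 / (4 * A) := by positivity
    linarith
  have hsum := summable_sq_mul_geometric hq0 hq1
  set M := 8 * A ^ 2 * m * μ.real (closedBall c r) / r with hM
  have hM0 : 0 ≤ M := by positivity
  calc _ ≤ _ := WeightedGarsia.lintegral_mul_poisson_le hr hr1 hK μ hF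
    _ ≤ ∑ k ∈ Finset.range (K + 1), ENNReal.ofReal (M * (((k : ℝ) + 1) ^ 2 * q ^ k)) := by
        refine Finset.sum_le_sum fun k hk => ?_
        have hkK : (2 : ℝ) ^ k * r ≤ 1 := le_trans (by
          gcongr
          · norm_num
          · exact Nat.lt_succ_iff.1 (Finset.mem_range.1 hk)) hK1
        refine (mul_le_mul_right (hFm k) _).trans ?_
        rw [← ENNReal.ofReal_mul (by positivity)]
        refine ENNReal.ofReal_le_ofReal ?_
        calc _ ≤ 2 / r * (1 / 4) ^ k * (m * ((k : ℝ) + 1) ^ 2 *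
              (4 * A ^ 2 * (4 * q) ^ k * μ.real (closedBall c r))) := by
              gcongr
              exact h.two_pow_mul_le c hr k hkK
          _ = _ := by
              have : (4 : ℝ) ^ k * (1 / 4) ^ k = 1 := by rw [← mul_pow]; norm_num
              rw [mul_pow, hM]
              linear_combination (8 * A ^ 2 * m * μ.real (closedBall c r) / r *
                (((k : ℝ) + 1) ^ 2 * q ^ k)) * this
    _ = ENNReal.ofReal (∑ k ∈ Finset.range (K + 1), M * (((k : ℝ) + 1) ^ 2 * q ^ k)) :=
        (ENNReal.ofReal_sum_of_nonneg fun k _ => by positivity).symm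
    _ ≤ ENNReal.ofReal (∑' k : ℕ, M * (((k : ℝ) + 1) ^ 2 * q ^ k)) :=
        ENNReal.ofReal_le_ofReal ((hsum.mul_left M).sum_le_tsum _ fun k _ => by positivity)
    _ = _ := by
        rw [tsum_mul_left, poissonConstant, hM]
        congr 1; ring

theorem lintegral_poisson_le (h : IsA2Pair μ σ A) (c : UnitAddCircle) {r : ℝ} (hr : 0 < r)
    (hr1 : r ≤ 1) : ∫⁻ t, ENNReal.ofReal (poisson (diskPoint c r) t) ∂μ
      ≤ ENNReal.ofReal (poissonConstant A * μ.real (closedBall c r) / r) := by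
  have := h.lintegral_mul_poisson_le (c := c) hr hr1 (F := fun _ => 1) aemeasurable_const
    zero_le_one fun k => by
      rw [lintegral_one, Measure.restrict_apply_univ, ← ofReal_measureReal, one_mul]
      refine ENNReal.ofReal_le_ofReal (le_mul_of_one_le_left measureReal_nonneg ?_)
      exact one_le_pow₀ (by linarith [k.cast_nonneg (α := ℝ)])
  simpa using this

/-- The mean square of `f - f_B` against the Poisson kernel, for the average `f_B` of `f` over
the ball `B` that belongs to the kernel. -/
theorem lintegral_sq_norm_sub_average_mul_poisson_le (h : IsA2Pair μ σ A) {f : UnitAddCircle → ℂ}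
    (hf : Integrable f μ) {B : ℝ} (hB : MeanOscillationLE μ f B) (hB0 : 0 < B)
    (c : UnitAddCircle) {r : ℝ} (hr : 0 < r) (hr1 : r ≤ 1) :
    ∫⁻ t, ENNReal.ofReal (‖f t - ⨍ y in closedBall c r, f y ∂μ‖ ^ 2) *
        ENNReal.ofReal (poisson (diskPoint c r) t) ∂μ
      ≤ ENNReal.ofReal ((2 * IsDoublingWith.johnNirenbergConstant (4 * A) + 2 * (4 * A) ^ 2) *
          B ^ 2 * poissonConstant A * μ.real (closedBall c r) / r) := by
  have hμ := h.isDoublingWith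
  have hA := h.one_le
  set J := IsDoublingWith.johnNirenbergConstant (4 * A) with hJ
  have hJ0 : 0 ≤ J := IsDoublingWith.johnNirenbergConstant_nonneg _
  refine h.lintegral_mul_poisson_le hr hr1
    ((integrable_norm_sub hf _).aemeasurable.pow_const 2).ennreal_ofReal (by positivity)
    fun k => ?_
  set a := ⨍ y in closedBall c r, f y ∂μ with ha
  set b := ⨍ y in closedBall c (2 ^ k * r), f y ∂μ with hb
  have h1 := hμ.norm_average_two_pow_sub_le hf hB hB0.le c hr k
  have h2 := hμ.lintegral_sq_norm_sub_average_le hf hB hB0 c (r := 2 ^ k * r) (by positivity)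
  calc _ ≤ ∫⁻ t in closedBall c (2 ^ k * r), (2 * ENNReal.ofReal (‖f t - b‖ ^ 2)
          + 2 * ENNReal.ofReal (‖b - a‖ ^ 2)) ∂μ :=
        lintegral_mono fun t => ofReal_sq_norm_sub_le _ _ _
    _ = 2 * ∫⁻ t in closedBall c (2 ^ k * r), ENNReal.ofReal (‖f t - b‖ ^ 2) ∂μ
          + 2 * ENNReal.ofReal (‖b - a‖ ^ 2) * μ (closedBall c (2 ^ k * r)) := by
        rw [lintegral_add_right _ measurable_const, lintegral_const_mul' _ _ (by simp),
          lintegral_const, Measure.restrict_apply_univ]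
    _ ≤ 2 * ENNReal.ofReal (J * B ^ 2 * μ.real (closedBall c (2 ^ k * r)))
          + 2 * ENNReal.ofReal ((k * (4 * A * B)) ^ 2) * μ (closedBall c (2 ^ k * r)) := by
        gcongr
    _ = ENNReal.ofReal (2 * (J * B ^ 2 * μ.real (closedBall c (2 ^ k * r)))
          + 2 * (k * (4 * A * B)) ^ 2 * μ.real (closedBall c (2 ^ k * r))) := by
        rw [← ENNReal.ofReal_ofNat 2, ← ofReal_measureReal, ← ENNReal.ofReal_mul (by norm_num),
          ← ENNReal.ofReal_mul (by norm_num), ← ENNReal.ofReal_mul (by positivity),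
          ← ENNReal.ofReal_add (by positivity) (by positivity)]
    _ ≤ _ := by
        refine ENNReal.ofReal_le_ofReal ?_
        have hk : (0 : ℝ) ≤ k := k.cast_nonneg
        have h3 : (1 : ℝ) ≤ ((k : ℝ) + 1) ^ 2 := one_le_pow₀ (by linarith)
        calc _ = (2 * J * B ^ 2 * 1 + 2 * (4 * A) ^ 2 * B ^ 2 * (k : ℝ) ^ 2) *
              μ.real (closedBall c (2 ^ k * r)) := by ring
          _ ≤ (2 * J * B ^ 2 * ((k : ℝ) + 1) ^ 2 + 2 * (4 * A) ^ 2 * B ^ 2 * ((k : ℝ) + 1) ^ 2) *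
              μ.real (closedBall c (2 ^ k * r)) := by
            gcongr
            linarith
          _ = _ := by ring

end IsA2Pair

/-! ### The measures of an `A₂` weight -/

/-- The measure `w dm`. -/
noncomputable def weightMeasure (w : UnitAddCircle → ℝ) : Measure UnitAddCircle :=
  volume.withDensity fun t => ENNReal.ofReal (w t)

/-- The measure `w⁻¹ dm`. -/
noncomputable def dualMeasure (w : UnitAddCircle → ℝ) : Measure UnitAddCircle :=
  volume.withDensity fun t => (ENNReal.ofReal (w t))⁻¹

theorem weightMeasure_apply (w : UnitAddCircle → ℝ) {s : Set UnitAddCircle}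
    (hs : MeasurableSet s) : weightMeasure w s = ∫⁻ t in s, ENNReal.ofReal (w t) :=
  withDensity_apply _ hs

theorem measurableSet_arc (c : UnitAddCircle) (h : ℝ) : MeasurableSet (arc c h) :=
  measurableSet_closedBall

theorem closedBall_eq_univ (c : UnitAddCircle) {r : ℝ} (hr : 1 / 2 ≤ r) :
    closedBall c r = univ :=
  eq_univ_of_forall fun t => mem_closedBall.2 ((dist_le_half t c).trans hr)

theorem exists_closedBall_eq_arc (c : UnitAddCircle) {r : ℝ} (hr : 0 < r) :
    ∃ h, 0 < h ∧ h ≤ 1 ∧ closedBall c r = arc c h := by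
  rcases le_total (1 / 2) r with hr' | hr'
  · exact ⟨1, one_pos, le_rfl, by rw [arc, closedBall_eq_univ c hr', closedBall_eq_univ c le_rfl]⟩
  · exact ⟨2 * r, by linarith, by linarith, by rw [arc, mul_div_cancel_left₀ r two_ne_zero]⟩

namespace IsA2Weight

variable {w : UnitAddCircle → ℝ}

theorem weightMeasure_apply_mul_dualMeasure_apply_le (w : UnitAddCircle → ℝ) (c : UnitAddCircle)
    {h : ℝ} (h0 : 0 < h) (h1 : h ≤ 1) :
    weightMeasure w (arc c h) / volume (arc c h) * (dualMeasure w (arc c h) / volume (arc c h))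
      ≤ a2Characteristic w := by
  rw [weightMeasure, dualMeasure, withDensity_apply _ (measurableSet_arc c h),
    withDensity_apply _ (measurableSet_arc c h)]
  exact le_iSup_of_le c (le_iSup_of_le h (le_iSup_of_le ⟨h0, h1⟩ le_rfl))

theorem aemeasurable_ofReal (hw : IsA2Weight w) : AEMeasurable (fun t => ENNReal.ofReal (w t)) :=
  hw.aemeasurable.ennreal_ofReal

theorem aemeasurable_inv_ofReal (hw : IsA2Weight w) :
    AEMeasurable (fun t => (ENNReal.ofReal (w t))⁻¹) :=
  hw.aemeasurable_ofReal.inv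

theorem measure_univ_lt_top (hw : IsA2Weight w) :
    weightMeasure w univ < ∞ ∧ dualMeasure w univ < ∞ := by
  have h1 := (weightMeasure_apply_mul_dualMeasure_apply_le w 0 one_pos le_rfl).trans_lt hw.finite
  rw [arc, closedBall_eq_univ 0 le_rfl, UnitAddCircle.measure_univ, div_one, div_one] at h1
  have h2 : weightMeasure w univ ≠ 0 := by
    rw [weightMeasure, withDensity_apply _ .univ, Measure.restrict_univ, ne_eq,
      lintegral_eq_zero_iff' hw.aemeasurable_ofReal]
    intro h
    obtain ⟨t, ht, ht'⟩ := (h.and hw.pos).exists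
    exact (ENNReal.ofReal_pos.2 ht').ne' ht
  have h3 : dualMeasure w univ ≠ 0 := by
    rw [dualMeasure, withDensity_apply _ .univ, Measure.restrict_univ, ne_eq,
      lintegral_eq_zero_iff' hw.aemeasurable_inv_ofReal]
    intro h
    obtain ⟨t, ht⟩ := h.exists
    exact ENNReal.inv_ne_zero.2 ENNReal.ofReal_ne_top ht
  rcases ENNReal.mul_lt_top_iff.1 h1 with h | h | h
  · exact h
  · exact absurd h h2
  · exact absurd h h3

theorem isFiniteMeasure_weightMeasure (hw : IsA2Weight w) : IsFiniteMeasure (weightMeasure w) :=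
  ⟨hw.measure_univ_lt_top.1⟩

theorem isFiniteMeasure_dualMeasure (hw : IsA2Weight w) : IsFiniteMeasure (dualMeasure w) :=
  ⟨hw.measure_univ_lt_top.2⟩

/-- The Cauchy–Schwarz inequality for the splitting `g p = (g √p √w) (√p / √w)`. -/
theorem sq_lintegral_mul_le (hw : IsA2Weight w) {g p : UnitAddCircle → ℝ≥0∞}
    (hg : AEMeasurable g) (hp : AEMeasurable p) :
    (∫⁻ t, g t * p t) ^ 2
      ≤ (∫⁻ t, g t ^ 2 * p t ∂weightMeasure w) * ∫⁻ t, p t ∂dualMeasure w := by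
  have hgp : AEMeasurable fun t => g t ^ 2 * p t := (hg.pow_const 2).mul hp
  rw [weightMeasure, dualMeasure,
    lintegral_withDensity_eq_lintegral_mul₀ hw.aemeasurable_ofReal hgp,
    lintegral_withDensity_eq_lintegral_mul₀ hw.aemeasurable_inv_ofReal hp]
  refine sq_lintegral_le_of_le_sqrt_mul (hw.aemeasurable_ofReal.mul hgp)
    (hw.aemeasurable_inv_ofReal.mul hp) ?_
  filter_upwards [hw.pos] with t ht
  rw [← ENNReal.mul_rpow_of_nonneg _ _ (by norm_num)]
  have h1 := ENNReal.mul_inv_cancel (ENNReal.ofReal_pos.2 ht).ne' ENNReal.ofReal_ne_top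
  have h2 : (((fun t => ENNReal.ofReal (w t)) * fun t => g t ^ 2 * p t) t) *
      (((fun t => (ENNReal.ofReal (w t))⁻¹) * p) t) = (g t * p t) ^ 2 := by
    simp only [Pi.mul_apply]
    calc _ = (g t * p t) ^ 2 * (ENNReal.ofReal (w t) * (ENNReal.ofReal (w t))⁻¹) := by ring
      _ = _ := by rw [h1, mul_one]
  rw [h2, ← ENNReal.rpow_natCast, ← ENNReal.rpow_mul]
  norm_num

theorem isA2Pair (hw : IsA2Weight w) :
    IsA2Pair (weightMeasure w) (dualMeasure w) (a2Characteristic w).toReal where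
  sq_le s hs := by
    have := hw.isFiniteMeasure_weightMeasure
    have := hw.isFiniteMeasure_dualMeasure
    have h := hw.sq_lintegral_mul_le (g := fun _ => 1) (p := s.indicator fun _ => 1)
      aemeasurable_const (aemeasurable_const.indicator hs)
    simp only [one_mul, one_pow, lintegral_indicator_const hs] at h
    have h' := ENNReal.toReal_mono (ENNReal.mul_ne_top (measure_ne_top _ _) (measure_ne_top _ _)) h
    rwa [ENNReal.toReal_pow, ENNReal.toReal_mul] at h'
  mul_le c r hr := by
    obtain ⟨h, h0, h1, heq⟩ := exists_closedBall_eq_arc c hr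
    have hv : 0 < (volume : Measure UnitAddCircle).real (closedBall c r) := by
      rw [volume_real_closedBall c hr.le]; positivity
    rw [heq] at hv ⊢
    have h2 := ENNReal.toReal_mono hw.finite.ne
      (weightMeasure_apply_mul_dualMeasure_apply_le w c h0 h1)
    rw [ENNReal.toReal_mul, ENNReal.toReal_div, ENNReal.toReal_div, div_mul_div_comm, ← sq] at h2
    exact (div_le_iff₀ (pow_pos hv 2)).1 h2

theorem lintegral_weightMeasure (hw : IsA2Weight w) {F : UnitAddCircle → ℝ≥0∞}
    (hF : AEMeasurable F) {s : Set UnitAddCircle} (hs : MeasurableSet s) :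
    ∫⁻ t in s, F t ∂weightMeasure w = ∫⁻ t in s, F t * ENNReal.ofReal (w t) := by
  rw [weightMeasure, restrict_withDensity hs,
    lintegral_withDensity_eq_lintegral_mul₀ hw.aemeasurable_ofReal.restrict hF.restrict]
  exact lintegral_congr fun t => mul_comm _ _

theorem integrable_weightMeasure_iff (hw : IsA2Weight w) (φ : UnitAddCircle → ℂ) :
    Integrable φ (weightMeasure w) ↔ Integrable (fun t => φ t * (w t : ℂ)) := by
  rw [weightMeasure, integrable_withDensity_iff_integrable_smul₀' hw.aemeasurable_ofReal
    (ae_of_all _ fun _ => ENNReal.ofReal_lt_top)]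
  refine integrable_congr ?_
  filter_upwards [hw.pos] with t ht
  rw [ENNReal.toReal_ofReal ht.le, Complex.real_smul, mul_comm]

theorem weightMeasure_real (hw : IsA2Weight w) {s : Set UnitAddCircle} (hs : MeasurableSet s) :
    (weightMeasure w).real s = ∫ t in s, w t := by
  rw [Measure.real, weightMeasure, withDensity_apply _ hs,
    integral_eq_lintegral_of_nonneg_ae (ae_restrict_of_ae (hw.pos.mono fun t ht => ht.le))
      hw.aemeasurable.restrict.aestronglyMeasurable]

theorem weightedAverage_eq (hw : IsA2Weight w) (φ : UnitAddCircle → ℂ) {s : Set UnitAddCircle}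
    (hs : MeasurableSet s) : weightedAverage w φ s = ⨍ t in s, φ t ∂weightMeasure w := by
  rw [setAverage_eq, weightedAverage, hw.weightMeasure_real hs, weightMeasure,
    setIntegral_withDensity_eq_setIntegral_toReal_smul₀ hw.aemeasurable_ofReal.restrict
      (ae_of_all _ fun _ => ENNReal.ofReal_lt_top) _ hs, Complex.real_smul, div_eq_inv_mul]
  push_cast
  congr 1
  refine setIntegral_congr_ae hs ?_
  filter_upwards [hw.pos] with t ht _
  rw [ENNReal.toReal_ofReal ht.le, Complex.real_smul, mul_comm]

end IsA2Weight

/-! ### Harmonic extensions -/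

/-- The Poisson kernel has mean one: the Poisson integral formula for the constant `1`. -/
theorem integral_poisson {z : ℂ} (hz : ‖z‖ < 1) : ∫ t, (poisson z t : ℂ) = 1 := by
  have h := DiffContOnCl.circleAverage_poissonKernel_smul (f := fun _ => (1 : ℂ)) (c := 0) (R := 1)
    (w := z) diffContOnCl_const (by simpa using hz)
  rw [Real.circleAverage_def] at h
  rw [← UnitAddCircle.intervalIntegral_preimage 0, ← h, zero_add]
  have h2 := intervalIntegral.integral_comp_mul_left (a := 0) (b := 1)
    (fun θ => (poissonKernel 0 z • fun _ => (1 : ℂ)) (circleMap 0 1 θ)) Real.two_pi_pos.ne'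
  rw [mul_zero, mul_one] at h2
  rw [← h2]
  refine intervalIntegral.integral_congr fun t _ => ?_
  have h3 : circleMap 0 1 (2 * Real.pi * t) = (AddCircle.toCircle (t : UnitAddCircle) : ℂ) := by
    rw [AddCircle.toCircle_apply_mk, Circle.coe_exp, circleMap_zero, div_one]
    simp
  simp only [Pi.smul_apply', h3, poisson, Complex.real_smul, mul_one]

theorem harmonicExtension_sub_const {φ : UnitAddCircle → ℂ} (hφ : Integrable φ)
    {c : UnitAddCircle} {r : ℝ} (hr : 0 < r) (hr1 : r ≤ 1) (a : ℂ) :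
    harmonicExtension φ (diskPoint c r) - a
      = ∫ t, (φ t - a) * (poisson (diskPoint c r) t : ℂ) := by
  have hP : Continuous fun t => (poisson (diskPoint c r) t : ℂ) :=
    Complex.continuous_ofReal.comp (continuous_poisson_diskPoint hr hr1)
  have h1 : Integrable fun t => φ t * (poisson (diskPoint c r) t : ℂ) := by
    refine hφ.mul_bdd (c := 2 * r / r ^ 2) hP.aestronglyMeasurable (ae_of_all _ fun t => ?_)
    rw [Complex.norm_real, Real.norm_of_nonneg (poisson_diskPoint_nonneg hr hr1)]
    exact poisson_diskPoint_le hr hr1 hr (le_norm_sub_diskPoint hr1)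
  have h2 : Integrable fun t => a * (poisson (diskPoint c r) t : ℂ) :=
    (hP.integrable_of_hasCompactSupport (HasCompactSupport.of_compactSpace _)).const_mul a
  simp_rw [sub_mul]
  rw [integral_sub h1 h2, integral_const_mul, integral_poisson (norm_diskPoint_lt_one hr hr1),
    mul_one, harmonicExtension]

namespace IsA2Weight

variable {w : UnitAddCircle → ℝ} {φ : UnitAddCircle → ℂ}

/-- The harmonic extension is an average of `φ` against the Poisson kernel, so its distance to a
constant `a` is controlled by the weighted mean square of `φ - a`. -/
theorem sq_norm_harmonicExtension_sub_le (hw : IsA2Weight w) (hφ : Integrable φ)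
    {c : UnitAddCircle} {r : ℝ} (hr : 0 < r) (hr1 : r ≤ 1) (a : ℂ) :
    ENNReal.ofReal (‖a - harmonicExtension φ (diskPoint c r)‖ ^ 2)
      ≤ (∫⁻ t, ENNReal.ofReal (‖φ t - a‖ ^ 2) * ENNReal.ofReal (poisson (diskPoint c r) t)
          ∂weightMeasure w) *
        ∫⁻ t, ENNReal.ofReal (poisson (diskPoint c r) t) ∂dualMeasure w := by
  have h1 := hw.sq_lintegral_mul_le (g := fun t => ENNReal.ofReal ‖φ t - a‖)
    (p := fun t => ENNReal.ofReal (poisson (diskPoint c r) t))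
    (integrable_norm_sub hφ a).aemeasurable.ennreal_ofReal
    (continuous_poisson_diskPoint hr hr1).measurable.ennreal_ofReal.aemeasurable
  have h2 : ENNReal.ofReal ‖a - harmonicExtension φ (diskPoint c r)‖
      ≤ ∫⁻ t, ENNReal.ofReal ‖φ t - a‖ * ENNReal.ofReal (poisson (diskPoint c r) t) := by
    rw [norm_sub_rev, harmonicExtension_sub_const hφ hr hr1, ofReal_norm]
    refine (enorm_integral_le_lintegral_enorm _).trans_eq (lintegral_congr fun t => ?_)
    rw [enorm_mul, ofReal_norm, ← ofReal_norm (poisson _ t : ℂ),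
      Complex.norm_real, Real.norm_of_nonneg (poisson_diskPoint_nonneg hr hr1)]
  simp only [← ENNReal.ofReal_pow (norm_nonneg _)] at h1
  rw [ENNReal.ofReal_pow (norm_nonneg _)]
  exact (pow_le_pow_left' h2 2).trans h1

theorem lintegral_norm_sub_mul_eq (hw : IsA2Weight w) (hφ : AEStronglyMeasurable φ volume) (a : ℂ)
    {s : Set UnitAddCircle} (hs : MeasurableSet s) :
    ∫⁻ t in s, ENNReal.ofReal (‖φ t - a‖ * w t)
      = ∫⁻ t in s, ENNReal.ofReal ‖φ t - a‖ ∂weightMeasure w := by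
  have hm : AEMeasurable fun t => ENNReal.ofReal ‖φ t - a‖ :=
    (hφ.sub aestronglyMeasurable_const).norm.aemeasurable.ennreal_ofReal
  rw [hw.lintegral_weightMeasure hm hs]
  exact lintegral_congr fun t => ENNReal.ofReal_mul (norm_nonneg _)

theorem meanOscillationLE (hw : IsA2Weight w) (hφ : AEStronglyMeasurable φ volume)
    (hφw : Integrable φ (weightMeasure w)) {b : ℝ} (hb : 0 ≤ b)
    (h : weightedBMONorm w φ ≤ ENNReal.ofReal b) :
    MeanOscillationLE (weightMeasure w) φ b := by
  have := hw.isFiniteMeasure_weightMeasure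
  intro c r hr
  have hpos := hw.isA2Pair.pos c hr
  obtain ⟨h', h0, h1, heq⟩ := exists_closedBall_eq_arc c hr
  rw [heq] at hpos ⊢
  rw [weightedBMONorm, if_pos ((hw.integrable_weightMeasure_iff φ).1 hφw)] at h
  have h2 := le_trans (le_iSup_of_le c (le_iSup_of_le h' (le_iSup_of_le ⟨h0, h1⟩ le_rfl))) h
  have hI := measurableSet_arc c h'
  rw [hw.weightedAverage_eq φ hI, ← weightMeasure_apply w hI] at h2
  set a := ⨍ t in arc c h', φ t ∂weightMeasure w with ha
  rw [hw.lintegral_norm_sub_mul_eq hφ a hI,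
    ← ofReal_integral_eq_lintegral_ofReal (integrable_norm_sub hφw a).integrableOn
    (ae_of_all _ fun _ => norm_nonneg _), ← ofReal_measureReal, ← ENNReal.ofReal_div_of_pos hpos,
    ENNReal.ofReal_le_ofReal_iff hb, div_le_iff₀ hpos] at h2
  exact h2

/-- Integrability against `w dm` alone does not give integrability against `dm`; the square
integrability from the John–Nirenberg inequality does, because `w⁻¹` is integrable. -/
theorem integrable_of_meanOscillationLE (hw : IsA2Weight w) (hφ : AEStronglyMeasurable φ volume)
    (hφw : Integrable φ (weightMeasure w)) {b : ℝ} (hb : 0 < b)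
    (h : MeanOscillationLE (weightMeasure w) φ b) : Integrable φ := by
  have := hw.isFiniteMeasure_weightMeasure
  have := hw.isFiniteMeasure_dualMeasure
  have h1 := hw.isA2Pair.isDoublingWith.lintegral_sq_norm_sub_average_le hφw h hb 0 one_pos
  rw [closedBall_eq_univ 0 (by norm_num), Measure.restrict_univ] at h1
  set a := ⨍ y, φ y ∂weightMeasure w with ha
  have hm : AEStronglyMeasurable (fun t => φ t - a) volume := hφ.sub aestronglyMeasurable_const
  have h2 := hw.sq_lintegral_mul_le (g := fun t => ENNReal.ofReal ‖φ t - a‖) (p := fun _ => 1)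
    hm.norm.aemeasurable.ennreal_ofReal aemeasurable_const
  simp only [mul_one, ← ENNReal.ofReal_pow (norm_nonneg _), lintegral_one] at h2
  have h3 : ∫⁻ t, ENNReal.ofReal ‖φ t - a‖ < ∞ := by
    have h4 := h2.trans_lt
      (ENNReal.mul_lt_top (h1.trans_lt ENNReal.ofReal_lt_top) (measure_lt_top _ _))
    by_contra! h5
    rw [top_le_iff.1 h5] at h4
    simp at h4
  have h6 : Integrable fun t => φ t - a :=
    ⟨hm, by simpa only [HasFiniteIntegral, ofReal_norm] using h3⟩
  exact (h6.add (integrable_const a)).congr (ae_of_all _ fun _ => sub_add_cancel _ _)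

/-- The numerator of the weighted Garsia norm as an integral against `w dm`. -/
theorem lintegral_garsia_eq (hw : IsA2Weight w) (hφ : AEStronglyMeasurable φ volume)
    {c : UnitAddCircle} {r : ℝ} (hr : 0 < r) (hr1 : r ≤ 1) (a : ℂ) :
    ∫⁻ t, ENNReal.ofReal (‖φ t - a‖ ^ 2 * poisson (diskPoint c r) t * w t)
      = ∫⁻ t, ENNReal.ofReal (‖φ t - a‖ ^ 2) * ENNReal.ofReal (poisson (diskPoint c r) t)
          ∂weightMeasure w := by
  have h := hw.lintegral_weightMeasure (s := univ)
    (F := fun t => ENNReal.ofReal (‖φ t - a‖ ^ 2) * ENNReal.ofReal (poisson (diskPoint c r) t))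
    (((hφ.sub aestronglyMeasurable_const).norm.aemeasurable.pow_const 2).ennreal_ofReal.mul
      (continuous_poisson_diskPoint hr hr1).measurable.ennreal_ofReal.aemeasurable) .univ
  rw [Measure.restrict_univ, Measure.restrict_univ] at h
  rw [h]
  refine lintegral_congr fun t => ?_
  have hP := poisson_diskPoint_nonneg (c := c) (t := t) hr hr1
  rw [ENNReal.ofReal_mul (by positivity), ENNReal.ofReal_mul (by positivity)]

/-- The denominator of the weighted Garsia norm as an integral against `w dm`. -/
theorem lintegral_mul_poisson_eq (hw : IsA2Weight w) {c : UnitAddCircle} {r : ℝ} (hr : 0 < r)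
    (hr1 : r ≤ 1) : ∫⁻ t, ENNReal.ofReal (w t * poisson (diskPoint c r) t)
      = ∫⁻ t, ENNReal.ofReal (poisson (diskPoint c r) t) ∂weightMeasure w := by
  have h := hw.lintegral_weightMeasure (s := univ)
    (F := fun t => ENNReal.ofReal (poisson (diskPoint c r) t))
    (continuous_poisson_diskPoint hr hr1).measurable.ennreal_ofReal.aemeasurable .univ
  rw [Measure.restrict_univ, Measure.restrict_univ] at h
  rw [h]
  refine lintegral_congr fun t => ?_
  rw [mul_comm, ENNReal.ofReal_mul (poisson_diskPoint_nonneg hr hr1)]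

/-! ### Comparison of the two norms -/

/-- The square of the constant in the bound of the Garsia norm by the `BMO` norm, in terms of the
`A₂` characteristic `A`. -/
noncomputable def garsiaConstant (A : ℝ) : ℝ :=
  128 * (2 * IsDoublingWith.johnNirenbergConstant (4 * A) + 2 * (4 * A) ^ 2) *
    IsA2Pair.poissonConstant A * (1 + 4 * A * IsA2Pair.poissonConstant A ^ 2)

theorem weightedGarsiaNorm_le_of_weightedBMONorm_le (hw : IsA2Weight w)
    (hφ : AEStronglyMeasurable φ volume) {b : ℝ} (hb : 0 < b)
    (h : weightedBMONorm w φ ≤ ENNReal.ofReal b) :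
    weightedGarsiaNorm w φ
      ≤ ENNReal.ofReal (√(garsiaConstant (a2Characteristic w).toReal) * b) := by
  have := hw.isFiniteMeasure_weightMeasure
  have := hw.isFiniteMeasure_dualMeasure
  have hp := hw.isA2Pair
  have hφw : Integrable φ (weightMeasure w) := by
    rw [hw.integrable_weightMeasure_iff]
    by_contra h'
    rw [weightedBMONorm, if_neg h'] at h
    exact absurd h (by simp)
  have hosc := hw.meanOscillationLE hφ hφw hb.le h
  have hφ1 := hw.integrable_of_meanOscillationLE hφ hφw hb hosc
  rw [weightedGarsiaNorm, if_pos hφ1]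
  refine iSup₂_le fun z hz => ?_
  obtain ⟨c, r, hr, hr1, rfl⟩ := exists_eq_diskPoint hz
  rw [hw.lintegral_garsia_eq hφ hr hr1, hw.lintegral_mul_poisson_eq hr hr1]
  set μ := weightMeasure w with hμ
  set σ := dualMeasure w with hσ
  set A := (a2Characteristic w).toReal with hA
  have hA1 : 1 ≤ A := hp.one_le
  set T := IsA2Pair.poissonConstant A with hT
  have hT0 : 0 ≤ T := hp.poissonConstant_nonneg
  set E := 2 * IsDoublingWith.johnNirenbergConstant (4 * A) + 2 * (4 * A) ^ 2 with hE
  have hE0 : 0 ≤ E := by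
    have := IsDoublingWith.johnNirenbergConstant_nonneg (4 * A)
    positivity
  set a := ⨍ y in closedBall c r, φ y ∂μ with ha
  set H := harmonicExtension φ (diskPoint c r) with hH
  set m := μ.real (closedBall c r) with hm
  set s := σ.real (closedBall c r) with hs
  have hm0 : 0 < m := hp.pos c hr
  have hms : m * s ≤ 4 * A * r ^ 2 := by
    refine (hp.mul_le c r hr).trans ?_
    rw [volume_real_closedBall c hr.le]
    calc A * min 1 (2 * r) ^ 2 ≤ A * (2 * r) ^ 2 := by gcongr; exact min_le_right _ _
      _ = _ := by ring
  set V := E * b ^ 2 * T * m / r with hV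
  have hV0 : 0 ≤ V := by positivity
  have h1 : ∫⁻ t, ENNReal.ofReal (‖φ t - a‖ ^ 2) *
      ENNReal.ofReal (poisson (diskPoint c r) t) ∂μ ≤ ENNReal.ofReal V :=
    hp.lintegral_sq_norm_sub_average_mul_poisson_le hφw hosc hb c hr hr1
  have h2 := hp.lintegral_poisson_le c hr hr1
  have h3 := hp.symm.lintegral_poisson_le c hr hr1
  have h4 := IsA2Pair.le_lintegral_poisson (μ := μ) c hr hr1
  have h5 : ENNReal.ofReal (‖a - H‖ ^ 2) ≤ ENNReal.ofReal V * ENNReal.ofReal (T * s / r) :=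
    (hw.sq_norm_harmonicExtension_sub_le hφ1 hr hr1 a).trans (mul_le_mul' h1 h3)
  have hPm : Measurable fun t => ENNReal.ofReal (poisson (diskPoint c r) t) :=
    (continuous_poisson_diskPoint hr hr1).measurable.ennreal_ofReal
  have h6 : ∫⁻ t, ENNReal.ofReal (‖φ t - H‖ ^ 2) *
      ENNReal.ofReal (poisson (diskPoint c r) t) ∂μ
      ≤ ENNReal.ofReal ((√(garsiaConstant A) * b) ^ 2) *
        ∫⁻ t, ENNReal.ofReal (poisson (diskPoint c r) t) ∂μ := by
    calc _ ≤ ∫⁻ t, (2 * (ENNReal.ofReal (‖φ t - a‖ ^ 2) *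
            ENNReal.ofReal (poisson (diskPoint c r) t)) +
            2 * ENNReal.ofReal (‖a - H‖ ^ 2) * ENNReal.ofReal (poisson (diskPoint c r) t)) ∂μ := by
          refine lintegral_mono fun t => ?_
          refine (mul_le_mul_left (ofReal_sq_norm_sub_le (φ t) a H) _).trans_eq ?_
          ring
      _ = 2 * (∫⁻ t, ENNReal.ofReal (‖φ t - a‖ ^ 2) *
            ENNReal.ofReal (poisson (diskPoint c r) t) ∂μ) + 2 * ENNReal.ofReal (‖a - H‖ ^ 2) *
            ∫⁻ t, ENNReal.ofReal (poisson (diskPoint c r) t) ∂μ := by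
          rw [lintegral_add_right _ (hPm.const_mul _), lintegral_const_mul' _ _ (by simp),
            lintegral_const_mul' _ _ (ENNReal.mul_ne_top (by simp) ENNReal.ofReal_ne_top)]
      _ ≤ 2 * ENNReal.ofReal V + 2 * (ENNReal.ofReal V * ENNReal.ofReal (T * s / r)) *
            ENNReal.ofReal (T * m / r) := by gcongr
      _ = ENNReal.ofReal (2 * V + 2 * (V * (T * s / r)) * (T * m / r)) := by
          rw [← ENNReal.ofReal_ofNat 2, ← ENNReal.ofReal_mul (by positivity),
            ← ENNReal.ofReal_mul (by positivity), ← ENNReal.ofReal_mul (by positivity),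
            ← ENNReal.ofReal_mul (by positivity),
            ← ENNReal.ofReal_add (by positivity) (by positivity)]
      _ ≤ ENNReal.ofReal (garsiaConstant A * b ^ 2 * (m / (64 * r))) := by
          refine ENNReal.ofReal_le_ofReal ?_
          calc _ = 2 * V + 2 * V * T ^ 2 * (m * s) / r ^ 2 := by field_simp
            _ ≤ 2 * V + 2 * V * T ^ 2 * (4 * A * r ^ 2) / r ^ 2 := by gcongr
            _ = _ := by
                rw [garsiaConstant, hV]
                field_simp
                ring
      _ = ENNReal.ofReal ((√(garsiaConstant A) * b) ^ 2) * ENNReal.ofReal (m / (64 * r)) := by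
          have hG : 0 ≤ garsiaConstant A := by
            unfold garsiaConstant
            positivity
          rw [mul_pow, Real.sq_sqrt hG, ENNReal.ofReal_mul (by positivity)]
      _ ≤ _ := by gcongr
  have h7 := ENNReal.rpow_le_rpow (ENNReal.div_le_of_le_mul h6) (z := 1 / 2) (by norm_num)
  refine h7.trans_eq ?_
  rw [ENNReal.ofReal_rpow_of_nonneg (by positivity) (by norm_num), ← Real.sqrt_eq_rpow,
    Real.sqrt_sq (by positivity)]

/-- The Garsia norm bounds the weighted mean square of `φ - φ(z)` over the ball that belongs to
`z`. -/
theorem lintegral_sq_norm_sub_harmonicExtension_le (hw : IsA2Weight w)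
    (hφ : AEStronglyMeasurable φ volume) (hφ1 : Integrable φ) (c : UnitAddCircle) {r : ℝ}
    (hr : 0 < r) (hr1 : r ≤ 1) :
    ∫⁻ t in closedBall c r,
        ENNReal.ofReal (‖φ t - harmonicExtension φ (diskPoint c r)‖ ^ 2) ∂weightMeasure w
      ≤ ENNReal.ofReal (64 * IsA2Pair.poissonConstant (a2Characteristic w).toReal) *
        weightedGarsiaNorm w φ ^ 2 * weightMeasure w (closedBall c r) := by
  have := hw.isFiniteMeasure_weightMeasure
  have := hw.isFiniteMeasure_dualMeasure
  have hp := hw.isA2Pair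
  have hT0 := hp.poissonConstant_nonneg
  set T := IsA2Pair.poissonConstant (a2Characteristic w).toReal with hT
  set μ := weightMeasure w with hμ
  set m := μ.real (closedBall c r) with hm
  have hm0 : 0 < m := hp.pos c hr
  set H := harmonicExtension φ (diskPoint c r) with hH
  have hle := hp.lintegral_poisson_le c hr hr1
  have hge := IsA2Pair.le_lintegral_poisson (μ := μ) c hr hr1
  have h1 : ((∫⁻ t, ENNReal.ofReal (‖φ t - H‖ ^ 2) *
      ENNReal.ofReal (poisson (diskPoint c r) t) ∂μ) /
      ∫⁻ t, ENNReal.ofReal (poisson (diskPoint c r) t) ∂μ) ^ (1 / 2 : ℝ)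
      ≤ weightedGarsiaNorm w φ := by
    rw [← hw.lintegral_garsia_eq hφ hr hr1, ← hw.lintegral_mul_poisson_eq hr hr1,
      weightedGarsiaNorm, if_pos hφ1]
    exact le_iSup₂_of_le (diskPoint c r) (norm_diskPoint_lt_one hr hr1) le_rfl
  have h2 := pow_le_pow_left' h1 2
  rw [← ENNReal.rpow_natCast, ← ENNReal.rpow_mul, show (1 / 2 : ℝ) * (2 : ℕ) = 1 by norm_num,
    ENNReal.rpow_one, ENNReal.div_le_iff (ne_of_gt ((ENNReal.ofReal_pos.2 (by positivity)).trans_le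
      hge)) (hle.trans_lt ENNReal.ofReal_lt_top).ne] at h2
  have h3 := (le_lintegral_mul_poisson hr hr1 μ _).trans (h2.trans (mul_le_mul_right hle _))
  have h4 : ENNReal.ofReal (64 * r) * ENNReal.ofReal (1 / (64 * r)) = 1 := by
    rw [← ENNReal.ofReal_mul (by positivity), mul_one_div_cancel (by positivity),
      ENNReal.ofReal_one]
  calc _ = ENNReal.ofReal (64 * r) * (ENNReal.ofReal (1 / (64 * r)) *
        ∫⁻ t in closedBall c r, ENNReal.ofReal (‖φ t - H‖ ^ 2) ∂μ) := by
        rw [← mul_assoc, h4, one_mul]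
    _ ≤ ENNReal.ofReal (64 * r) * (weightedGarsiaNorm w φ ^ 2 * ENNReal.ofReal (T * m / r)) := by
        gcongr
    _ = ENNReal.ofReal (64 * r) * ENNReal.ofReal (T * m / r) * weightedGarsiaNorm w φ ^ 2 := by
        ring
    _ = ENNReal.ofReal (64 * T) * ENNReal.ofReal m * weightedGarsiaNorm w φ ^ 2 := by
        rw [← ENNReal.ofReal_mul (by positivity), ← ENNReal.ofReal_mul (by positivity)]
        congr 2
        field_simp
    _ = _ := by rw [hm, ofReal_measureReal]; ring

theorem weightedBMONorm_le_weightedGarsiaNorm (hw : IsA2Weight w)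
    (hφ : AEStronglyMeasurable φ volume) (h : weightedGarsiaNorm w φ ≠ ∞) :
    weightedBMONorm w φ
      ≤ ENNReal.ofReal (2 * √(64 * IsA2Pair.poissonConstant (a2Characteristic w).toReal)) *
        weightedGarsiaNorm w φ := by
  have := hw.isFiniteMeasure_weightMeasure
  have := hw.isFiniteMeasure_dualMeasure
  have hp := hw.isA2Pair
  have hT0 := hp.poissonConstant_nonneg
  have hφ1 : Integrable φ := by
    by_contra h'
    exact h (by rw [weightedGarsiaNorm, if_neg h'])
  set T := IsA2Pair.poissonConstant (a2Characteristic w).toReal with hT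
  set G := weightedGarsiaNorm w φ with hG
  set μ := weightMeasure w with hμ
  have hφμ : AEStronglyMeasurable φ μ := hφ.mono_ac (withDensity_absolutelyContinuous _ _)
  -- the mean deviation from the value of the harmonic extension
  have key : ∀ (c : UnitAddCircle) (r : ℝ), 0 < r → r ≤ 1 →
      ∫⁻ t in closedBall c r,
        ENNReal.ofReal ‖φ t - harmonicExtension φ (diskPoint c r)‖ ∂μ
      ≤ ENNReal.ofReal (√(64 * T)) * G * μ (closedBall c r) := by
    intro c r hr hr1
    set H := harmonicExtension φ (diskPoint c r) with hH
    have h1 := hw.lintegral_sq_norm_sub_harmonicExtension_le hφ hφ1 c hr hr1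
    have hm : AEMeasurable (fun t => ‖φ t - H‖) (μ.restrict (closedBall c r)) :=
      (hφμ.sub aestronglyMeasurable_const).norm.aemeasurable.restrict
    have h2 := sq_lintegral_le_of_le_sqrt_mul (ν := μ.restrict (closedBall c r))
      (g := fun t => ENNReal.ofReal ‖φ t - H‖) (F := fun t => ENNReal.ofReal (‖φ t - H‖ ^ 2))
      (G := fun _ => 1) (hm.pow_const 2).ennreal_ofReal aemeasurable_const
      (ae_of_all _ fun t => by
        rw [ENNReal.one_rpow, mul_one, ENNReal.ofReal_rpow_of_nonneg (by positivity) (by norm_num),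
          ← Real.sqrt_eq_rpow, Real.sqrt_sq (norm_nonneg _)])
    rw [lintegral_one, Measure.restrict_apply_univ] at h2
    rw [← ENNReal.pow_le_pow_left_iff two_ne_zero]
    refine h2.trans ((mul_le_mul_left h1 _).trans_eq ?_)
    rw [mul_pow, mul_pow, ← ENNReal.ofReal_pow (Real.sqrt_nonneg _),
      Real.sq_sqrt (by positivity)]
    ring
  have hφw : Integrable φ μ := by
    have h1 := key 0 1 one_pos le_rfl
    rw [closedBall_eq_univ 0 (by norm_num), Measure.restrict_univ] at h1
    set H := harmonicExtension φ (diskPoint 0 1) with hH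
    have h2 : Integrable (fun t => φ t - H) μ :=
      ⟨hφμ.sub aestronglyMeasurable_const, by
        simp only [HasFiniteIntegral, ← ofReal_norm]
        exact h1.trans_lt (ENNReal.mul_lt_top (ENNReal.mul_lt_top ENNReal.ofReal_lt_top
          h.lt_top) (measure_lt_top _ _))⟩
    exact (h2.add (integrable_const H)).congr (ae_of_all _ fun _ => sub_add_cancel _ _)
  rw [weightedBMONorm, if_pos ((hw.integrable_weightMeasure_iff φ).1 hφw)]
  refine iSup_le fun c => iSup_le fun ℓ => iSup_le fun hℓ => ?_
  have hI := measurableSet_arc c ℓ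
  have hr : 0 < ℓ / 2 := by linarith [hℓ.1]
  rw [hw.weightedAverage_eq φ hI, ← weightMeasure_apply w hI]
  refine ENNReal.div_le_of_le_mul ?_
  set a := ⨍ t in arc c ℓ, φ t ∂μ with ha
  set H := harmonicExtension φ (diskPoint c (ℓ / 2)) with hH
  have h4 : ∫ t in arc c ℓ, ‖φ t - a‖ ∂μ ≤ 2 * ∫ t in arc c ℓ, ‖φ t - H‖ ∂μ := by
    have h5 := norm_setAverage_sub_mul_le (hp.pos c hr) hφw H
    change ‖a - H‖ * μ.real (arc c ℓ) ≤ ∫ t in arc c ℓ, ‖φ t - H‖ ∂μ at h5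
    calc _ ≤ ∫ t in arc c ℓ, (‖φ t - H‖ + ‖a - H‖) ∂μ := by
          refine integral_mono (integrable_norm_sub hφw a).integrableOn
            ((integrable_norm_sub hφw H).add (integrable_const _)).integrableOn fun t => ?_
          rw [norm_sub_rev a H]
          exact norm_sub_le_norm_sub_add_norm_sub _ _ _
      _ = (∫ t in arc c ℓ, ‖φ t - H‖ ∂μ) + ‖a - H‖ * μ.real (arc c ℓ) := by
          rw [integral_add (integrable_norm_sub hφw H).integrableOn (integrable_const _),
            setIntegral_const, smul_eq_mul, mul_comm]
      _ ≤ _ := by linarith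
  calc _ = ENNReal.ofReal (∫ t in arc c ℓ, ‖φ t - a‖ ∂μ) := by
        rw [hw.lintegral_norm_sub_mul_eq hφ a hI,
          ofReal_integral_eq_lintegral_ofReal (integrable_norm_sub hφw a).integrableOn
          (ae_of_all _ fun _ => norm_nonneg _)]
    _ ≤ ENNReal.ofReal (2 * ∫ t in arc c ℓ, ‖φ t - H‖ ∂μ) := ENNReal.ofReal_le_ofReal h4
    _ = ENNReal.ofReal 2 * ∫⁻ t in arc c ℓ, ENNReal.ofReal ‖φ t - H‖ ∂μ := by
        rw [ENNReal.ofReal_mul zero_le_two,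
          ofReal_integral_eq_lintegral_ofReal (integrable_norm_sub hφw H).integrableOn
            (ae_of_all _ fun _ => norm_nonneg _)]
    _ ≤ ENNReal.ofReal 2 * (ENNReal.ofReal (√(64 * T)) * G * μ (arc c ℓ)) := by
        gcongr
        exact key c (ℓ / 2) hr (by linarith [hℓ.2])
    _ = _ := by
        rw [ENNReal.ofReal_mul zero_le_two]
        ring

end IsA2Weight

end WeightedGarsia

theorem lemmaL (w : UnitAddCircle → ℝ) (hw : WeightedGarsia.IsA2Weight w) :
    ∃ C₁ C₂ : ℝ≥0, 0 < C₁ ∧ 0 < C₂ ∧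
      ∀ φ : UnitAddCircle → ℂ, AEStronglyMeasurable φ volume →
        WeightedGarsia.weightedGarsiaNorm w φ ≤ C₁ * WeightedGarsia.weightedBMONorm w φ ∧
        WeightedGarsia.weightedBMONorm w φ ≤ C₂ * WeightedGarsia.weightedGarsiaNorm w φ := by
  set K₁ := √(WeightedGarsia.IsA2Weight.garsiaConstant
    (WeightedGarsia.a2Characteristic w).toReal) with hK₁
  set K₂ := 2 * √(64 * WeightedGarsia.IsA2Pair.poissonConstant
    (WeightedGarsia.a2Characteristic w).toReal) with hK₂
  have h₁ : ENNReal.ofReal K₁ ≤ (K₁.toNNReal + 1 : ℝ≥0) := by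
    rw [ENNReal.ofReal]
    exact_mod_cast le_self_add
  have h₂ : ENNReal.ofReal K₂ ≤ (K₂.toNNReal + 1 : ℝ≥0) := by
    rw [ENNReal.ofReal]
    exact_mod_cast le_self_add
  have hC₁ : 0 < K₁.toNNReal + 1 := by positivity
  refine ⟨K₁.toNNReal + 1, K₂.toNNReal + 1, hC₁, by positivity, fun φ hφ => ⟨?_, ?_⟩⟩
  · rcases eq_or_ne (WeightedGarsia.weightedBMONorm w φ) ∞ with h | h
    · rw [h, ENNReal.mul_top (by exact_mod_cast hC₁.ne')]
      exact le_top
    -- the `BMO` norm may vanish, so it is approached by positive bounds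
    refine ENNReal.le_of_forall_pos_le_add fun ε hε _ => ?_
    set C₁ := K₁.toNNReal + 1 with hC
    have hδ : 0 < ε / C₁ := by positivity
    set b := (WeightedGarsia.weightedBMONorm w φ).toReal + (ε / C₁ : ℝ≥0) with hb
    have hb0 : 0 < b := by positivity
    have hbe : ENNReal.ofReal b = WeightedGarsia.weightedBMONorm w φ + (ε / C₁ : ℝ≥0) := by
      rw [hb, ENNReal.ofReal_add ENNReal.toReal_nonneg (NNReal.coe_nonneg _),
        ENNReal.ofReal_toReal h, ENNReal.ofReal_coe_nnreal]
    have hG := hw.weightedGarsiaNorm_le_of_weightedBMONorm_le hφ hb0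
      (by rw [hbe]; exact le_self_add)
    rw [ENNReal.ofReal_mul (Real.sqrt_nonneg _), hbe] at hG
    refine hG.trans ((mul_le_mul_left h₁ _).trans_eq ?_)
    rw [mul_add, ← ENNReal.coe_mul, mul_div_cancel₀ _ hC₁.ne']
  · rcases eq_or_ne (WeightedGarsia.weightedGarsiaNorm w φ) ∞ with h | h
    · rw [h, ENNReal.mul_top (by positivity)]
      exact le_top
    · exact (hw.weightedBMONorm_le_weightedGarsiaNorm hφ h).trans (mul_le_mul_left h₂ _)
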